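/- Let $\beta>1$ be a Pisot unit of degree $d$ (an algebraic integer whose other Galois conjugates $\beta_2,\dots,\beta_d$ satisfy $|\beta_j|<1$ and whose minimal polynomial has constant term $\pm1$), and put $\beta_1=\beta$. Let $\Gamma_j:\mathbb{Q}(\beta)\to\mathbb{Q}(\beta_j)$ be the field isomorphism with $\Gamma_j(\beta)=\beta_j$, let $\mathbf{v}_j=\nu_j(\beta_j^{d-1},\dots,\beta_j,1)^t\in\mathbb{C}^d$, where the $\nu_j\in\mathbb{C}$ are chosen such that $\mathbf{v}_1+\cdots+\mathbf{v}_d=(1,0,\dots,0)^t$, let $H\subset\mathbb{R}^d$ be the hyperplane spanned by the real and imaginary parts of $\mathbf{v}_2,\dots,\mathbf{v}_d$, and let $\Phi:\mathbb{Q}(\beta)\to H$, $\Phi(x)=\sum_{j=2}^d\Gamma_j(x)\mathbf{v}_j$. Let $A\subset\mathbb{Z}[\beta]$ be a finite set, and let $T:X\to X$ be a right-continuous $\beta$-transformation with digit set $A$: $X$ is the disjoint union of non-empty sets $X_a$, $a\in A$, each $X_a=\bigcup_{i\in I_a}[\ell_i,r_i)$ is a finite union of intervals in $\mathbb{R}$,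 $\bigcup_{a\in A}(\beta X_a-a)=X$, and $Tx=\beta x-a$ for $x\in X_a$. Let $\widetilde{T}:\widetilde{X}\to\widetilde{X}$ be the corresponding left-continuous transformation, given by $\widetilde{T}x=\beta x-a$ for $x\in\widetilde{X}_a=\bigcup_{i\in I_a}(\ell_i,r_i]$, $\widetilde{X}=\bigcup_{a\in A}\widetilde{X}_a$. For $x\in X\cap\widetilde{X}$ let $m_x\in\{1,2,\dots\}\cup\{\infty\}$ be the smallest $m\ge1$ with $\widetilde{T}^mx=T^mx$ (and $m_x=\infty$ if there is none), and assume that the set \[ \mathcal{V}=(X\setminus\widetilde{X})\cup\bigcup_{x\in X\cap\widetilde{X}}\ \bigcup_{1\le k<m_x}\{T^kx,\widetilde{T}^kx\}\cap X \] is finite. For $x\in X$ let $b(x)=b_1(x)b_2(x)\cdots\in A^{\omega}$ be its $T$-expansion, i.e. $b_k(x)=a$ if $T^{k-1}x\in X_a$. Let $\mathcal{S}$ be the set of all $(u_k)_{k\in\mathbb{Z}}\in A^{\mathbb{Z}}$ such that for every $k\in\mathbb{Z}$ the sequence $u_ku_{k+1}\cdots$ equals $b(y)$ for some $y\in X$,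 and let \[ \mathcal{D}_x=\Big\{\sum_{k\le0}\Phi(w_k\beta^{-k}):\ (w_k)_{k\le0},\ \cdots w_{-1}w_0\,b_1(x)b_2(x)\cdots\in\mathcal{S}\Big\}\subset H . \] Then for every $x\in X$ the boundary of $\mathcal{D}_x$ in $H$ has measure zero: $\lambda^{d-1}(\partial\mathcal{D}_x)=0$, where $\lambda^{d-1}$ is the $(d-1)$-dimensional Lebesgue measure on $H$. -/

import Mathlib

open scoped IntermediateField

/-! ### Pisot units and the contracting hyperplane -/

/-- `β` is a Pisot unit: a real algebraic integer `β > 1` all of whose other Galois conjugates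
have modulus less than `1`, and whose minimal polynomial has constant term `±1`. -/
class IsPisotUnit (β : ℝ) : Prop where
  one_lt : 1 < β
  isIntegral : IsIntegral ℤ β
  norm_lt_one : ∀ z : ℂ, Polynomial.aeval z (minpoly ℤ β) = 0 → z ≠ (β : ℂ) → ‖z‖ < 1
  isUnit_coeff : IsUnit ((minpoly ℤ β).coeff 0)

instance IsPisotUnit.finiteDimensional (β : ℝ) [IsPisotUnit β] : FiniteDimensional ℚ ℚ⟮β⟯ :=
  IntermediateField.adjoin.finiteDimensional (IsPisotUnit.isIntegral (β := β)).tower_top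

/-- The generator `β`, seen as an element of the field `ℚ(β)`. -/
noncomputable abbrev genBeta (β : ℝ) : ℚ⟮β⟯ := IntermediateField.AdjoinSimple.gen ℚ β

/-- The Galois conjugates of `β` are `σ(β)`, where `σ` runs through the embeddings of `ℚ(β)`
into `ℂ` (the maps `Γ_j`); this is the identical embedding `Γ_1`. -/
noncomputable def idEmb (β : ℝ) : ℚ⟮β⟯ →ₐ[ℚ] ℂ :=
  (IsScalarTower.toAlgHom ℚ ℝ ℂ).comp (IntermediateField.val ℚ⟮β⟯)

/-- The degree `d` of `β`. -/
noncomputable def pisotDegree (β : ℝ) : ℕ := (minpoly ℤ β).natDegree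

/-- The normalizing constant `ν_σ = ∏_{τ ≠ σ} (σ(β) - τ(β))⁻¹`, i.e. the unique choice such that
the vectors `pisotVec β σ` add up to `e₁`, see `sum_pisotVec`. -/
noncomputable def pisotNu (β : ℝ) [IsPisotUnit β] (σ : ℚ⟮β⟯ →ₐ[ℚ] ℂ) : ℂ :=
  open Classical in
  ∏ τ ∈ Finset.univ.erase σ, (σ (genBeta β) - τ (genBeta β))⁻¹

/-- The eigenvector `v_σ = ν_σ (β_σ^(d-1), …, β_σ, 1)` of the companion matrix of `β`,
where `β_σ = σ(β)`. -/
noncomputable def pisotVec (β : ℝ) [IsPisotUnit β] (σ : ℚ⟮β⟯ →ₐ[ℚ] ℂ) :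
    Fin (pisotDegree β) → ℂ :=
  fun i => pisotNu β σ * σ (genBeta β) ^ (i.rev : ℕ)

lemma IsPisotUnit.natDegree_eq_card (β : ℝ) [IsPisotUnit β] :
    pisotDegree β = Fintype.card (ℚ⟮β⟯ →ₐ[ℚ] ℂ) := by
  have h : IsIntegral ℤ β := IsPisotUnit.isIntegral
  rw [AlgHom.card, IntermediateField.adjoin.finrank h.tower_top,
    minpoly.isIntegrallyClosed_eq_field_fractions' ℚ h, pisotDegree,
    (minpoly.monic h).natDegree_map]

lemma IsPisotUnit.genBeta_injective (β : ℝ) :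
    Function.Injective (fun σ : ℚ⟮β⟯ →ₐ[ℚ] ℂ => σ (genBeta β)) := by
  intro σ τ h
  apply IntermediateField.algHom_ext_of_eq_adjoin _ rfl
  rintro x rfl
  exact h

/-- The eigenvectors add up to the first standard basis vector. -/
lemma sum_pisotVec (β : ℝ) [IsPisotUnit β] (i : Fin (pisotDegree β)) :
    ∑ σ, pisotVec β σ i = if (i : ℕ) = 0 then 1 else 0 := by
  classical
  have hc := IsPisotUnit.natDegree_eq_card β
  have hi := i.isLt
  have := Lagrange.coeff_eq_sum (s := Finset.univ)
    (v := fun σ : ℚ⟮β⟯ →ₐ[ℚ] ℂ => σ (genBeta β))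
    (IsPisotUnit.genBeta_injective β).injOn (P := Polynomial.X ^ (i.rev : ℕ)) (by
      rw [Polynomial.degree_X_pow, Finset.card_univ, ← hc]
      exact_mod_cast i.rev.isLt)
  rw [Polynomial.coeff_X_pow, Finset.card_univ, ← hc, Fin.val_rev] at this
  have e : (pisotDegree β - 1 = pisotDegree β - (i + 1)) ↔ (i : ℕ) = 0 := by omega
  simp only [e] at this
  rw [this]
  refine Finset.sum_congr rfl fun σ _ => ?_
  simp only [pisotVec, pisotNu, Polynomial.eval_pow, Polynomial.eval_X, Fin.val_rev]
  rw [Finset.prod_inv_distrib, div_eq_mul_inv, mul_comm]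

/-- The real part of `v_σ`. -/
noncomputable def pisotVecRe (β : ℝ) [IsPisotUnit β] (σ : ℚ⟮β⟯ →ₐ[ℚ] ℂ) :
    EuclideanSpace ℝ (Fin (pisotDegree β)) :=
  WithLp.toLp 2 fun i => (pisotVec β σ i).re

/-- The imaginary part of `v_σ`. -/
noncomputable def pisotVecIm (β : ℝ) [IsPisotUnit β] (σ : ℚ⟮β⟯ →ₐ[ℚ] ℂ) :
    EuclideanSpace ℝ (Fin (pisotDegree β)) :=
  WithLp.toLp 2 fun i => (pisotVec β σ i).im

/-- The hyperplane `H` of `ℝ^d` spanned by the real and imaginary parts of the vectors `v_σ`,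
`σ` not the identity. -/
noncomputable def pisotH (β : ℝ) [IsPisotUnit β] :
    Submodule ℝ (EuclideanSpace ℝ (Fin (pisotDegree β))) :=
  Submodule.span ℝ (pisotVecRe β '' {idEmb β}ᶜ ∪ pisotVecIm β '' {idEmb β}ᶜ)

/-- The `(d-1)`-dimensional Lebesgue measure on `H`, normalized by an orthonormal basis. -/
noncomputable def lebesgueH (β : ℝ) [IsPisotUnit β] : MeasureTheory.Measure (pisotH β) :=
  (stdOrthonormalBasis ℝ (pisotH β)).toBasis.addHaar

open Classical in
/-- The map `Φ : ℚ(β) → H`, `Φ(x) = ∑_{σ ≠ id} σ(x) v_σ`. It is written through the real parts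
of the summands; the complex sum is real, see `coe_pisotPhi`. -/
noncomputable def pisotPhi (β : ℝ) [IsPisotUnit β] (x : ℚ⟮β⟯) : pisotH β :=
  ⟨∑ σ ∈ Finset.univ.erase (idEmb β),
      ((σ x).re • pisotVecRe β σ - (σ x).im • pisotVecIm β σ),
    Submodule.sum_mem _ fun σ hσ =>
      have hσ' : σ ∈ ({idEmb β}ᶜ : Set _) := (Finset.mem_erase.mp hσ).1
      Submodule.sub_mem _
        (Submodule.smul_mem _ _ (Submodule.subset_span (Or.inl ⟨σ, hσ', rfl⟩)))
        (Submodule.smul_mem _ _ (Submodule.subset_span (Or.inr ⟨σ, hσ', rfl⟩)))⟩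

/-- Complex conjugation as an involution of the set of embeddings. -/
noncomputable def conjEmb (β : ℝ) (σ : ℚ⟮β⟯ →ₐ[ℚ] ℂ) : ℚ⟮β⟯ →ₐ[ℚ] ℂ :=
  ((Complex.conjAe.restrictScalars ℚ).toAlgHom).comp σ

lemma conjEmb_apply (β : ℝ) (σ : ℚ⟮β⟯ →ₐ[ℚ] ℂ) (x : ℚ⟮β⟯) :
    conjEmb β σ x = starRingEnd ℂ (σ x) := rfl

lemma conjEmb_conjEmb (β : ℝ) (σ : ℚ⟮β⟯ →ₐ[ℚ] ℂ) : conjEmb β (conjEmb β σ) = σ := by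
  ext x; simp [conjEmb_apply]

lemma conjEmb_idEmb (β : ℝ) : conjEmb β (idEmb β) = idEmb β := by
  apply AlgHom.ext
  intro x
  rw [conjEmb_apply]
  exact Complex.conj_ofReal _

lemma pisotVec_conjEmb (β : ℝ) [IsPisotUnit β] (σ : ℚ⟮β⟯ →ₐ[ℚ] ℂ)
    (i : Fin (pisotDegree β)) :
    pisotVec β (conjEmb β σ) i = starRingEnd ℂ (pisotVec β σ i) := by
  classical
  simp only [pisotVec, pisotNu, map_mul, map_pow, map_prod, conjEmb_apply]
  congr 1
  refine Finset.prod_nbij' (conjEmb β) (conjEmb β) ?_ ?_ ?_ ?_ ?_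
  · intro τ hτ
    simp only [Finset.mem_erase, Finset.mem_univ, and_true] at hτ ⊢
    rintro rfl
    exact hτ (conjEmb_conjEmb β τ).symm
  · intro τ hτ
    simp only [Finset.mem_erase, Finset.mem_univ, and_true] at hτ ⊢
    intro h
    exact hτ (by rw [← conjEmb_conjEmb β τ, h, conjEmb_conjEmb])
  · intro τ _; exact conjEmb_conjEmb β τ
  · intro τ _; exact conjEmb_conjEmb β τ
  · intro τ _
    simp [conjEmb_apply]

/-- `Φ(x)` is the complex vector `∑_{σ ≠ id} σ(x) v_σ`, which has real entries. -/
lemma coe_pisotPhi (β : ℝ) [IsPisotUnit β] (x : ℚ⟮β⟯) (i : Fin (pisotDegree β)) :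
    ((((pisotPhi β x : EuclideanSpace ℝ (Fin (pisotDegree β))) i : ℝ)) : ℂ) =
      open Classical in ∑ σ ∈ Finset.univ.erase (idEmb β), σ x * pisotVec β σ i := by
  classical
  have hre : (pisotPhi β x : EuclideanSpace ℝ (Fin (pisotDegree β))) i =
      (∑ σ ∈ Finset.univ.erase (idEmb β), σ x * pisotVec β σ i).re := by
    simp only [pisotPhi, pisotVecRe, pisotVecIm, Complex.re_sum, Complex.mul_re,
      WithLp.ofLp_sum, WithLp.ofLp_sub, WithLp.ofLp_smul, Finset.sum_apply, Pi.sub_apply,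
      Pi.smul_apply, smul_eq_mul]
  have hconj : starRingEnd ℂ (∑ σ ∈ Finset.univ.erase (idEmb β), σ x * pisotVec β σ i) =
      ∑ σ ∈ Finset.univ.erase (idEmb β), σ x * pisotVec β σ i := by
    rw [map_sum]
    refine Finset.sum_nbij' (conjEmb β) (conjEmb β) ?_ ?_ ?_ ?_ ?_
    · intro τ hτ
      simp only [Finset.mem_erase, Finset.mem_univ, and_true] at hτ ⊢
      intro h
      exact hτ (by rw [← conjEmb_conjEmb β τ, h, conjEmb_idEmb])
    · intro τ hτ
      simp only [Finset.mem_erase, Finset.mem_univ, and_true] at hτ ⊢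
      intro h
      exact hτ (by rw [← conjEmb_conjEmb β τ, h, conjEmb_idEmb])
    · intro τ _; exact conjEmb_conjEmb β τ
    · intro τ _; exact conjEmb_conjEmb β τ
    · intro τ _
      rw [map_mul, pisotVec_conjEmb, conjEmb_apply]
  rw [hre, Complex.conj_eq_iff_re.mp hconj]

/-! ### Right-continuous `β`-transformations -/

/-- A right-continuous `β`-transformation: a finite set `A` of digits and, for every `a ∈ A`, a
non-empty finite union `X_a` of intervals `[ℓ, r)` (given by their pairs of endpoints), such that
the sets `X_a` are pairwise disjoint and `⋃_a (β X_a - a) = ⋃_a X_a`. -/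
structure RightContBetaTransformation (β : ℝ) where
  one_lt : 1 < β
  /-- the set `A` of digits -/
  digits : Finset ℝ
  /-- the endpoints of the intervals of which `X_a` is the union (relevant for `a ∈ A` only) -/
  intervals : ℝ → Finset (ℝ × ℝ)
  intervals_nonempty : ∀ a ∈ digits, (intervals a).Nonempty
  left_lt_right : ∀ a ∈ digits, ∀ p ∈ intervals a, p.1 < p.2
  disjoint : ∀ a ∈ digits, ∀ a' ∈ digits, a ≠ a' →
    Disjoint (⋃ p ∈ intervals a, Set.Ico p.1 p.2) (⋃ p ∈ intervals a', Set.Ico p.1 p.2)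
  surjective : (⋃ a ∈ digits, (fun x => β * x - a) '' ⋃ p ∈ intervals a, Set.Ico p.1 p.2) =
    ⋃ a ∈ digits, ⋃ p ∈ intervals a, Set.Ico p.1 p.2

namespace RightContBetaTransformation

variable {β : ℝ} (T : RightContBetaTransformation β)

/-- The set `X_a`. -/
def piece (a : ℝ) : Set ℝ := ⋃ p ∈ T.intervals a, Set.Ico p.1 p.2

/-- The domain `X`. -/
def X : Set ℝ := ⋃ a ∈ T.digits, T.piece a

/-- The set `X̃_a`. -/
def leftPiece (a : ℝ) : Set ℝ := ⋃ p ∈ T.intervals a, Set.Ioc p.1 p.2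

/-- The domain `X̃` of the corresponding left-continuous transformation. -/
def leftX : Set ℝ := ⋃ a ∈ T.digits, T.leftPiece a

/-- The first digit `b₁(x)`: the unique `a ∈ A` with `x ∈ X_a`, for `x ∈ X` (and `0` off `X`). -/
noncomputable def digit (x : ℝ) : ℝ := ∑ a ∈ T.digits, (T.piece a).indicator (fun _ => a) x

/-- The first digit of `x` with respect to the left-continuous transformation: the unique `a ∈ A`
with `x ∈ X̃_a`, for `x ∈ X̃` (and `0` off `X̃`). -/
noncomputable def leftDigit (x : ℝ) : ℝ :=
  ∑ a ∈ T.digits, (T.leftPiece a).indicator (fun _ => a) x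

/-- The transformation `T`, which maps `X` onto `X` (its values off `X` are irrelevant). -/
noncomputable def map (x : ℝ) : ℝ := β * x - T.digit x

/-- The left-continuous transformation `T̃`, which maps `X̃` to `X̃` (its values off `X̃` are
irrelevant). -/
noncomputable def leftMap (x : ℝ) : ℝ := β * x - T.leftDigit x

lemma digit_eq {a x : ℝ} (ha : a ∈ T.digits) (hx : x ∈ T.piece a) : T.digit x = a := by
  rw [digit, Finset.sum_eq_single a, Set.indicator_of_mem hx]
  · intro b hb hba
    exact Set.indicator_of_notMem
      (fun h => Set.disjoint_left.mp (T.disjoint b hb a ha hba) h hx) _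
  · exact fun h => absurd ha h

/-- The `T`-expansion `b(x)`; here `expansion x n` is the digit `b_{n+1}(x)`. -/
noncomputable def expansion (x : ℝ) : ℕ → ℝ := fun n => T.digit (T.map^[n] x)

/-- A right-infinite sequence is `T`-admissible if it is the `T`-expansion of some `x ∈ X`. -/
def Admissible (u : ℕ → ℝ) : Prop := ∃ x ∈ T.X, u = T.expansion x

/-- The set `𝒮` of two-sided sequences all of whose right tails are `T`-admissible. -/
def twoSided : Set (ℤ → ℝ) :=
  {u | (∀ k, u k ∈ T.digits) ∧ ∀ k : ℤ, T.Admissible fun n : ℕ => u (k + n)}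

/-- The time `m_x ∈ {1, 2, …, ∞}`: the smallest `m ≥ 1` with `T̃^m x = T^m x`. -/
noncomputable def mergeTime (x : ℝ) : ℕ∞ :=
  sInf {m : ℕ∞ | ∃ n : ℕ, m = n ∧ 1 ≤ n ∧ T.leftMap^[n] x = T.map^[n] x}

/-- The set `𝒱 = (X \ X̃) ∪ ⋃_{x ∈ X ∩ X̃} ⋃_{1 ≤ k < m_x} {T^k x, T̃^k x} ∩ X`. -/
def V : Set ℝ :=
  (T.X \ T.leftX) ∪ ⋃ x ∈ T.X ∩ T.leftX, ⋃ k ∈ {k : ℕ | 1 ≤ k ∧ (k : ℕ∞) < T.mergeTime x},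
    ({T.map^[k] x, T.leftMap^[k] x} ∩ T.X)

/-- The two-sided sequence `w · v`. The left-infinite sequence `w = (w_k)_{k ≤ 0}` over `ℚ(β)` is
indexed by `w n = w_{-n}`, the right-infinite one `v = (v_k)_{k ≥ 1}` by `v n = v_{n+1}`. -/
noncomputable def concat (w : ℕ → ℚ⟮β⟯) (v : ℕ → ℝ) : ℤ → ℝ :=
  fun k => if k ≤ 0 then (w (-k).toNat : ℝ) else v (k - 1).toNat

/-- The set `𝒟_x = {φ(w) : w · b(x) ∈ 𝒮} ⊆ H`, with `φ(w) = ∑_{k ≤ 0} Φ(w_k β^{-k})`. (The digits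
of `T` are supposed to lie in `ℚ(β)`.) -/
def tile [IsPisotUnit β] (x : ℝ) : Set (pisotH β) :=
  {y | ∃ w : ℕ → ℚ⟮β⟯, concat w (T.expansion x) ∈ T.twoSided ∧
    HasSum (fun n => pisotPhi β (w n * genBeta β ^ n)) y}

end RightContBetaTransformation

/-! Write `M` for multiplication by `β` transported to `H`, and `μ(x)` for the measure of `∂𝒟_x`.
Grouping the backward orbits of `x` by their first step gives `𝒟_x = ⋃_{Ty=x} (Φ(b₁(y)) + M 𝒟_y)`.
Here `M` contracts, because `β` is Pisot, and `|det M| = β⁻¹`, because `β` is a unit. A point of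
`∂𝒟_x` cannot come from the interior of a piece, so `μ(x) ≤ β⁻¹ ∑_{Ty=x} μ(y)`. The right-hand side
is the transfer operator of `T`, which preserves Lebesgue integrals. Both sides therefore have the
same finite integral and agree almost everywhere.

Finiteness of `𝒱` makes `𝒟_x` constant on intervals `[x, x']` of the domain with no point of `𝒱` in
`(x, x']` (`branchTile_eq_of_Ioc`): a long backward branch of `x` is shifted to one of `x'`. If the
shift runs into a gap of the domain, a jump by one of finitely many elements of `ℤ[β]` bypasses it,
at a cost in `H` that `M^N` makes negligible. So both sides of the inequality are locally constant
from the right, and equality holds everywhere (`boundaryMeasure_eq`). The covering of `∂𝒟_x` by the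
boundaries of its pieces is then tight: each affine image of `∂𝒟_y` lies in `∂𝒟_{T^n y}` up to a
null set (`measure_image_iterate_frontier_diff`).

Suppose `μ(x₀) > 0` and let `S = {x ∈ X : μ(x) ≠ 0}`. By the equality `T` maps `S` onto itself, and
`S` contains an interval to the right of `x₀`. The subtiles built from backward orbits in `S` alone,
translated by `Φ(x)` for `x ∈ ℤ[β] ∩ S`, cover `H` (`exists_sub_mem_branchTile`). By Baire some
subtile has an interior point `p`. A sufficiently deep piece around `p` comes from some `y ∈ S` and
lies in the interior of the full tile, yet by tightness almost all of its boundary, which has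
positive measure, lies in the boundary of that tile: a contradiction. -/

/-! ### The companion matrix and its action on the contracting hyperplane -/

/-- The companion matrix of the minimal polynomial of `β`, with eigenvectors `pisotVec β σ`. -/
noncomputable def pisotCompanion (β : ℝ) :
    Matrix (Fin (pisotDegree β)) (Fin (pisotDegree β)) ℤ :=
  fun i j => if (i : ℕ) = 0 then -(minpoly ℤ β).coeff j.rev
    else if (j : ℕ) + 1 = i then 1 else 0

section Companion

variable (β : ℝ) [IsPisotUnit β]

omit [IsPisotUnit β] in
lemma aeval_emb_genBeta (σ : ℚ⟮β⟯ →ₐ[ℚ] ℂ) :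
    Polynomial.aeval (σ (genBeta β)) (minpoly ℤ β) = 0 := by
  have h : Polynomial.aeval (genBeta β) (minpoly ℤ β) = 0 := by
    apply Subtype.val_injective
    have := Polynomial.aeval_algHom_apply ((IntermediateField.val ℚ⟮β⟯).restrictScalars ℤ)
      (genBeta β) (minpoly ℤ β)
    have h2 := minpoly.aeval ℤ β
    change (ℚ⟮β⟯.val.restrictScalars ℤ) _ = 0
    rw [← this]
    exact h2
  have := Polynomial.aeval_algHom_apply (σ.restrictScalars ℤ) (genBeta β) (minpoly ℤ β)
  rw [h, map_zero] at this
  exact this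

/-- The first row encodes the minimal polynomial evaluated at `σ(β)`; every other row shifts the
exponents by one. -/
lemma companion_mulVec_pisotVec (σ : ℚ⟮β⟯ →ₐ[ℚ] ℂ) (i : Fin (pisotDegree β)) :
    ∑ j, (pisotCompanion β i j : ℂ) * pisotVec β σ j = σ (genBeta β) * pisotVec β σ i := by
  set x := σ (genBeta β) with hx
  by_cases hi : (i : ℕ) = 0
  · have hroot := aeval_emb_genBeta β σ
    have hmon : (minpoly ℤ β).Monic := minpoly.monic IsPisotUnit.isIntegral
    rw [Polynomial.aeval_eq_sum_range, Finset.sum_range_succ, hmon.coeff_natDegree, one_smul,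
      ← hx] at hroot
    have e : ∑ j : Fin (pisotDegree β), ((minpoly ℤ β).coeff (j.rev : ℕ) : ℂ) * x ^ (j.rev : ℕ)
        = -x ^ pisotDegree β := by
      rw [← Equiv.sum_comp Fin.revPerm]
      simp only [Fin.revPerm_apply, Fin.rev_rev]
      rw [Fin.sum_univ_eq_sum_range (fun k => ((minpoly ℤ β).coeff k : ℂ) * x ^ k)]
      simp only [zsmul_eq_mul] at hroot
      exact eq_neg_of_add_eq_zero_left hroot
    have e2 : x ^ pisotDegree β = x * x ^ (i.rev : ℕ) := by
      rw [← pow_succ', Fin.val_rev]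
      congr 1
      have := i.isLt
      omega
    calc _ = pisotNu β σ * -∑ j : Fin (pisotDegree β),
          ((minpoly ℤ β).coeff (j.rev : ℕ) : ℂ) * x ^ (j.rev : ℕ) := by
          rw [← Finset.sum_neg_distrib, Finset.mul_sum]
          refine Finset.sum_congr rfl fun j _ => ?_
          simp only [pisotCompanion, hi, if_true, pisotVec, ← hx]
          push_cast
          ring
      _ = _ := by
          rw [e, neg_neg, e2, pisotVec]
          ring
  · have hlt := i.isLt
    rw [Finset.sum_eq_single ⟨(i : ℕ) - 1, by omega⟩]
    · have h1 : (i : ℕ) - 1 + 1 = i := by omega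
      simp only [pisotCompanion, hi, if_false, h1, if_true, pisotVec, ← hx, Fin.val_rev]
      rw [show pisotDegree β - i = (pisotDegree β - (i + 1)) + 1 by omega, pow_succ]
      push_cast
      ring
    · intro j _ hj
      have : ¬ ((j : ℕ) + 1 = i) := fun h => hj (Fin.ext (by simp only; omega))
      simp [pisotCompanion, hi, this]
    · simp

/-- The linear map of `ℝ^d` given by the companion matrix. -/
noncomputable def companionMap :
    EuclideanSpace ℝ (Fin (pisotDegree β)) →ₗ[ℝ] EuclideanSpace ℝ (Fin (pisotDegree β)) :=
  Matrix.toLpLin 2 2 ((pisotCompanion β).map (Int.cast : ℤ → ℝ))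

omit [IsPisotUnit β] in
lemma companionMap_apply (u : EuclideanSpace ℝ (Fin (pisotDegree β))) (i : Fin (pisotDegree β)) :
    companionMap β u i = ∑ j, (pisotCompanion β i j : ℝ) * u j := by
  simp [companionMap, Matrix.toLpLin_apply, Matrix.mulVec, dotProduct]

/-- The real part of `z v_σ`. -/
noncomputable def pisotLine (σ : ℚ⟮β⟯ →ₐ[ℚ] ℂ) (z : ℂ) :
    EuclideanSpace ℝ (Fin (pisotDegree β)) :=
  z.re • pisotVecRe β σ - z.im • pisotVecIm β σ

lemma pisotLine_apply (σ : ℚ⟮β⟯ →ₐ[ℚ] ℂ) (z : ℂ) (i : Fin (pisotDegree β)) :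
    pisotLine β σ z i = (z * pisotVec β σ i).re := by
  simp [pisotLine, pisotVecRe, pisotVecIm]

lemma companionMap_pisotLine (σ : ℚ⟮β⟯ →ₐ[ℚ] ℂ) (z : ℂ) :
    companionMap β (pisotLine β σ z) = pisotLine β σ (σ (genBeta β) * z) := by
  ext i
  rw [companionMap_apply]
  simp only [pisotLine_apply]
  rw [mul_comm (σ _) z, mul_assoc, ← companion_mulVec_pisotVec, Finset.mul_sum, Complex.re_sum]
  refine Finset.sum_congr rfl fun j _ => ?_
  rw [← Complex.ofReal_intCast, mul_left_comm, Complex.re_ofReal_mul]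

lemma pisotLine_one (σ : ℚ⟮β⟯ →ₐ[ℚ] ℂ) : pisotLine β σ 1 = pisotVecRe β σ := by
  simp [pisotLine]

lemma pisotLine_neg_I (σ : ℚ⟮β⟯ →ₐ[ℚ] ℂ) : pisotLine β σ (-Complex.I) = pisotVecIm β σ := by
  simp [pisotLine]

lemma norm_pisotLine_le (σ : ℚ⟮β⟯ →ₐ[ℚ] ℂ) (z : ℂ) :
    ‖pisotLine β σ z‖ ≤ ‖z‖ * (‖pisotVecRe β σ‖ + ‖pisotVecIm β σ‖) := by
  refine (norm_sub_le _ _).trans ?_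
  rw [norm_smul, norm_smul, mul_add, Real.norm_eq_abs, Real.norm_eq_abs]
  gcongr
  · exact Complex.abs_re_le_norm z
  · exact Complex.abs_im_le_norm z

lemma pisotLine_mem {σ : ℚ⟮β⟯ →ₐ[ℚ] ℂ} (hσ : σ ≠ idEmb β) (z : ℂ) :
    pisotLine β σ z ∈ pisotH β :=
  Submodule.sub_mem _
    (Submodule.smul_mem _ _ (Submodule.subset_span (Or.inl ⟨σ, hσ, rfl⟩)))
    (Submodule.smul_mem _ _ (Submodule.subset_span (Or.inr ⟨σ, hσ, rfl⟩)))

/-- Induction principle for the hyperplane `H`. -/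
lemma pisotH_induction {p : EuclideanSpace ℝ (Fin (pisotDegree β)) → Prop}
    (line : ∀ σ ≠ idEmb β, ∀ z, p (pisotLine β σ z)) (zero : p 0)
    (add : ∀ u v, p u → p v → p (u + v)) (smul : ∀ (c : ℝ) u, p u → p (c • u))
    {u : EuclideanSpace ℝ (Fin (pisotDegree β))} (hu : u ∈ pisotH β) : p u := by
  induction hu using Submodule.span_induction with
  | mem u hu =>
    rcases hu with ⟨σ, hσ, rfl⟩ | ⟨σ, hσ, rfl⟩
    · exact pisotLine_one β σ ▸ line σ hσ 1
    · exact pisotLine_neg_I β σ ▸ line σ hσ _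
  | zero => exact zero
  | add u v _ _ hu hv => exact add u v hu hv
  | smul c u _ hu => exact smul c u hu

lemma companionMap_mem {u : EuclideanSpace ℝ (Fin (pisotDegree β))} (hu : u ∈ pisotH β) :
    companionMap β u ∈ pisotH β := by
  refine pisotH_induction β (p := fun u => companionMap β u ∈ pisotH β)
    (fun σ hσ z => ?_) ?_ (fun u v hu hv => ?_) (fun c u hu => ?_) hu
  · rw [companionMap_pisotLine]
    exact pisotLine_mem β hσ _
  · simp
  · rw [map_add]
    exact Submodule.add_mem _ hu hv
  · rw [map_smul]
    exact Submodule.smul_mem _ _ hu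

/-- The restriction of the companion map to the contracting hyperplane. -/
noncomputable def pisotM : pisotH β →L[ℝ] pisotH β :=
  LinearMap.toContinuousLinearMap ((companionMap β).restrict fun _ h => companionMap_mem β h)

lemma coe_pisotM (h : pisotH β) :
    (pisotM β h : EuclideanSpace ℝ (Fin (pisotDegree β))) = companionMap β h := rfl

lemma coe_pisotM_pow (n : ℕ) (h : pisotH β) :
    ((pisotM β ^ n) h : EuclideanSpace ℝ (Fin (pisotDegree β))) = (companionMap β ^ n) h := by
  induction n with
  | zero => rfl
  | succ n ih =>
    rw [pow_succ', pow_succ', mul_apply_eq_comp, coe_pisotM, ih]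
    rfl

lemma coe_pisotPhi_eq_sum (x : ℚ⟮β⟯) :
    (pisotPhi β x : EuclideanSpace ℝ (Fin (pisotDegree β))) =
      open Classical in ∑ σ ∈ Finset.univ.erase (idEmb β), pisotLine β σ (σ x) := rfl

lemma pisotLine_add (σ : ℚ⟮β⟯ →ₐ[ℚ] ℂ) (z w : ℂ) :
    pisotLine β σ (z + w) = pisotLine β σ z + pisotLine β σ w := by
  ext i; simp [pisotLine_apply, add_mul]

lemma pisotPhi_add (x y : ℚ⟮β⟯) : pisotPhi β (x + y) = pisotPhi β x + pisotPhi β y := by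
  apply Subtype.val_injective
  rw [Submodule.coe_add]
  simp only [coe_pisotPhi_eq_sum, map_add, pisotLine_add, Finset.sum_add_distrib]

/-- `Φ` as a homomorphism of additive groups. -/
noncomputable def pisotPhiHom : ℚ⟮β⟯ →+ pisotH β := AddMonoidHom.mk' (pisotPhi β) (pisotPhi_add β)

lemma pisotPhi_zero : pisotPhi β 0 = 0 := map_zero (pisotPhiHom β)

lemma pisotPhi_genBeta_mul (x : ℚ⟮β⟯) :
    pisotPhi β (genBeta β * x) = pisotM β (pisotPhi β x) := by
  apply Subtype.val_injective
  rw [coe_pisotM]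
  simp only [coe_pisotPhi_eq_sum, map_mul, map_sum, companionMap_pisotLine]

lemma pisotPhi_genBeta_pow_mul (n : ℕ) (x : ℚ⟮β⟯) :
    pisotPhi β (genBeta β ^ n * x) = (pisotM β ^ n) (pisotPhi β x) := by
  induction n with
  | zero => simp
  | succ n ih =>
    rw [pow_succ', mul_assoc, pisotPhi_genBeta_mul, ih, pow_succ']
    rfl

/-! ### Contraction -/

lemma companionMap_pow_pisotLine (n : ℕ) (σ : ℚ⟮β⟯ →ₐ[ℚ] ℂ) (z : ℂ) :
    (companionMap β ^ n) (pisotLine β σ z) = pisotLine β σ (σ (genBeta β) ^ n * z) := by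
  induction n with
  | zero => simp
  | succ n ih =>
    rw [pow_succ', Module.End.mul_apply, ih, companionMap_pisotLine, pow_succ', mul_assoc]

lemma norm_emb_genBeta_lt_one {σ : ℚ⟮β⟯ →ₐ[ℚ] ℂ} (hσ : σ ≠ idEmb β) : ‖σ (genBeta β)‖ < 1 :=
  IsPisotUnit.norm_lt_one (β := β) _ (aeval_emb_genBeta β σ) fun h =>
    hσ (IsPisotUnit.genBeta_injective β h)

lemma exists_contraction_rate :
    ∃ ρ : ℝ, 0 < ρ ∧ ρ < 1 ∧ ∀ σ ≠ idEmb β, ‖σ (genBeta β)‖ ≤ ρ := by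
  classical
  set s := Finset.univ.erase (idEmb β)
  set r := s.sup (fun σ => ‖σ (genBeta β)‖₊) with hr
  have h1 : r < 1 := (Finset.sup_lt_iff zero_lt_one).2 fun σ hσ =>
    norm_emb_genBeta_lt_one β (Finset.mem_erase.1 hσ).1
  -- The value `1 / 2` only serves to make the rate positive.
  refine ⟨max r (1 / 2), by positivity, max_lt h1 (by norm_num), fun σ hσ => ?_⟩
  refine le_max_of_le_left ?_
  exact_mod_cast Finset.le_sup (f := fun σ : ℚ⟮β⟯ →ₐ[ℚ] ℂ => ‖σ (genBeta β)‖₊)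
    (Finset.mem_erase.2 ⟨hσ, Finset.mem_univ σ⟩)

/-- On the component of `σ` the map is multiplication by `σ(β)`, of modulus at most `ρ`. Decay of
single vectors becomes uniform by expanding in an orthonormal basis; the norm is not adapted to `M`,
hence the constant `C`. -/
lemma exists_norm_pisotM_pow_le :
    ∃ C ρ : ℝ, 0 < C ∧ 0 < ρ ∧ ρ < 1 ∧ ∀ n (h : pisotH β), ‖(pisotM β ^ n) h‖ ≤ C * ρ ^ n * ‖h‖ := by
  obtain ⟨ρ, hρ0, hρ1, hρ⟩ := exists_contraction_rate β
  have key : ∀ u ∈ pisotH β, ∃ C : ℝ, 0 ≤ C ∧ ∀ n, ‖(companionMap β ^ n) u‖ ≤ C * ρ ^ n := by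
    intro u hu
    refine pisotH_induction β
      (p := fun u => ∃ C : ℝ, 0 ≤ C ∧ ∀ n, ‖(companionMap β ^ n) u‖ ≤ C * ρ ^ n)
      (fun σ hσ z => ?_) ?_ (fun u v hu hv => ?_) (fun c u hu => ?_) hu
    · refine ⟨‖z‖ * (‖pisotVecRe β σ‖ + ‖pisotVecIm β σ‖), by positivity, fun n => ?_⟩
      rw [companionMap_pow_pisotLine]
      refine (norm_pisotLine_le β σ _).trans ?_
      rw [norm_mul, norm_pow, mul_assoc, mul_comm _ (ρ ^ n)]
      gcongr
      exact hρ σ hσ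
    · exact ⟨0, le_rfl, fun n => by simp⟩
    · obtain ⟨C, hC, h1⟩ := hu
      obtain ⟨D, hD, h2⟩ := hv
      refine ⟨C + D, by positivity, fun n => ?_⟩
      rw [map_add, add_mul]
      exact (norm_add_le _ _).trans (add_le_add (h1 n) (h2 n))
    · obtain ⟨C, hC, h1⟩ := hu
      refine ⟨|c| * C, by positivity, fun n => ?_⟩
      rw [map_smul, norm_smul, mul_assoc, Real.norm_eq_abs]
      gcongr
      exact h1 n
  set b := stdOrthonormalBasis ℝ (pisotH β)
  choose C hC0 hC using fun i => key (b i) (b i).2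
  refine ⟨∑ i, C i + 1, ρ, add_pos_of_nonneg_of_pos (Finset.sum_nonneg fun i _ => hC0 i) one_pos,
    hρ0, hρ1, fun n h => ?_⟩
  have hle : ‖(pisotM β ^ n) h‖ ≤ ∑ i, ‖h‖ * (C i * ρ ^ n) := by
    conv_lhs => rw [← b.sum_repr h, map_sum]
    refine norm_sum_le_of_le _ fun i _ => ?_
    rw [map_smul, norm_smul]
    gcongr
    · calc ‖b.repr h i‖ ≤ ‖b.repr h‖ := PiLp.norm_apply_le _ i
        _ = ‖h‖ := b.repr.norm_map h
    · rw [Submodule.coe_norm, coe_pisotM_pow]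
      exact hC i n
  refine hle.trans ?_
  rw [← Finset.mul_sum, ← Finset.sum_mul, mul_comm]
  gcongr
  linarith

/-! ### The splitting of `ℝ^d` into the expanding line and the contracting hyperplane -/

/-- The expanding eigenvector `v₁`. -/
noncomputable def pisotV1 : EuclideanSpace ℝ (Fin (pisotDegree β)) := pisotVecRe β (idEmb β)

omit [IsPisotUnit β] in
lemma idEmb_apply (x : ℚ⟮β⟯) : idEmb β x = ((x : ℝ) : ℂ) := rfl

lemma pisotLine_idEmb (x : ℝ) : pisotLine β (idEmb β) x = x • pisotV1 β := by
  simp [pisotLine, pisotV1]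

lemma companionMap_pisotV1 : companionMap β (pisotV1 β) = β • pisotV1 β := by
  have h := companionMap_pisotLine β (idEmb β) 1
  rw [idEmb_apply, mul_one, pisotLine_one, pisotLine_idEmb] at h
  exact h

lemma pisotVec_idEmb_im (i : Fin (pisotDegree β)) : (pisotVec β (idEmb β) i).im = 0 := by
  rw [← Complex.conj_eq_iff_im, ← pisotVec_conjEmb, conjEmb_idEmb]

lemma pisotDegree_pos : 0 < pisotDegree β :=
  minpoly.natDegree_pos IsPisotUnit.isIntegral

lemma pisotV1_ne_zero : pisotV1 β ≠ 0 := by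
  classical
  intro h
  have h0 : ∀ i, pisotVec β (idEmb β) i = 0 := fun i => by
    apply Complex.ext
    · exact congrFun (congrArg WithLp.ofLp h) i
    · exact pisotVec_idEmb_im β i
  have := h0 ⟨0, pisotDegree_pos β⟩
  rw [pisotVec, mul_eq_zero] at this
  rcases this with h | h
  · rw [pisotNu, Finset.prod_eq_zero_iff] at h
    obtain ⟨τ, hτ, h⟩ := h
    rw [inv_eq_zero, sub_eq_zero] at h
    exact (Finset.mem_erase.1 hτ).1 (IsPisotUnit.genBeta_injective β h.symm)
  · have : idEmb β (genBeta β) = 0 := eq_zero_of_pow_eq_zero h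
    rw [idEmb_apply, Complex.ofReal_eq_zero] at this
    have h1 : (1 : ℝ) < β := IsPisotUnit.one_lt
    have h2 : ((genBeta β : ℚ⟮β⟯) : ℝ) = β := rfl
    linarith

/-- Powers of the companion map expand `v₁` by `β^n` but stay bounded on every vector of `H`. -/
lemma pisotV1_notMem : pisotV1 β ∉ pisotH β := by
  intro h
  obtain ⟨C, ρ, hC, hρ0, hρ1, hM⟩ := exists_norm_pisotM_pow_le β
  have h1 : (1 : ℝ) < β := IsPisotUnit.one_lt
  have hpow : ∀ n : ℕ, (companionMap β ^ n) (pisotV1 β) = β ^ n • pisotV1 β := by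
    intro n
    induction n with
    | zero => simp
    | succ n ih =>
      rw [pow_succ', Module.End.mul_apply, ih, map_smul, companionMap_pisotV1, smul_smul, pow_succ]
  have hpos : 0 < ‖pisotV1 β‖ := norm_pos_iff.2 (pisotV1_ne_zero β)
  obtain ⟨n, hn⟩ := pow_unbounded_of_one_lt C h1
  have := hM n ⟨_, h⟩
  rw [Submodule.coe_norm, coe_pisotM_pow, hpow, norm_smul, Submodule.coe_norm] at this
  have h2 : ‖β ^ n‖ = β ^ n := by rw [Real.norm_eq_abs, abs_of_nonneg (by positivity)]
  rw [h2] at this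
  have h3 : β ^ n ≤ C * ρ ^ n := le_of_mul_le_mul_right this hpos
  have h4 : C * ρ ^ n ≤ C * 1 := by
    gcongr
    exact pow_le_one₀ hρ0.le hρ1.le
  linarith

/-- The embedding `x ↦ ∑_σ σ(x) v_σ = x v₁ + Φ(x)`. -/
noncomputable def pisotL (x : ℚ⟮β⟯) : EuclideanSpace ℝ (Fin (pisotDegree β)) :=
  (x : ℝ) • pisotV1 β + pisotPhi β x

lemma pisotL_eq_sum (x : ℚ⟮β⟯) : pisotL β x = ∑ σ, pisotLine β σ (σ x) := by
  classical
  rw [pisotL, coe_pisotPhi_eq_sum, ← pisotLine_idEmb, ← idEmb_apply,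
    Finset.add_sum_erase _ (fun σ => pisotLine β σ (σ x)) (Finset.mem_univ _)]

/-- `pisotL` as a homomorphism of additive groups. -/
noncomputable def pisotLHom : ℚ⟮β⟯ →+ EuclideanSpace ℝ (Fin (pisotDegree β)) :=
  AddMonoidHom.mk' (pisotL β) fun x y => by
    simp only [pisotL_eq_sum, map_add, pisotLine_add, Finset.sum_add_distrib]

lemma pisotLHom_apply (x : ℚ⟮β⟯) : pisotLHom β x = pisotL β x := rfl

lemma pisotL_genBeta_mul (x : ℚ⟮β⟯) : pisotL β (genBeta β * x) = companionMap β (pisotL β x) := by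
  simp only [pisotL_eq_sum, map_sum, companionMap_pisotLine, map_mul]

lemma pisotL_one (i : Fin (pisotDegree β)) : pisotL β 1 i = if (i : ℕ) = 0 then 1 else 0 := by
  have h := congrArg Complex.re (sum_pisotVec β i)
  rw [Complex.re_sum] at h
  rw [pisotL_eq_sum]
  simp only [map_one, WithLp.ofLp_sum, Finset.sum_apply, pisotLine_apply, one_mul]
  rw [h]
  split_ifs <;> simp

/-- For `x ≠ 0` the relation `x v₁ = -Φ(x)` would put `v₁` into `H`. -/
lemma pisotL_eq_zero {x : ℚ⟮β⟯} (h : pisotL β x = 0) : x = 0 := by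
  by_contra hx
  have hx' : (x : ℝ) ≠ 0 := fun h => hx (Subtype.val_injective h)
  apply pisotV1_notMem β
  have : (x : ℝ) • pisotV1 β ∈ pisotH β := by
    rw [eq_neg_of_add_eq_zero_left h]
    exact Submodule.neg_mem _ (pisotPhi β x).2
  exact (Submodule.smul_mem_iff _ hx').1 this

lemma companionMap_single (k : Fin (pisotDegree β)) (hk : (k : ℕ) + 1 < pisotDegree β)
    (i : Fin (pisotDegree β)) :
    companionMap β (EuclideanSpace.single k 1) i =
      (pisotCompanion β ⟨0, pisotDegree_pos β⟩ k : ℝ) * (if (i : ℕ) = 0 then 1 else 0) +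
        (EuclideanSpace.single ⟨k + 1, hk⟩ (1 : ℝ) : EuclideanSpace ℝ _) i := by
  rw [companionMap_apply, Finset.sum_eq_single k]
  · by_cases hi : (i : ℕ) = 0
    · have : i ≠ ⟨k + 1, hk⟩ := fun h => by simp [h] at hi
      simp [pisotCompanion, hi, this]
    · by_cases h : i = ⟨k + 1, hk⟩
      · simp [pisotCompanion, h]
      · have : ¬ ((k : ℕ) + 1 = i) := fun h' => h (Fin.ext h'.symm)
        simp [pisotCompanion, hi, h, this]
  · intro j _ hj
    simp [hj]
  · simp

omit [IsPisotUnit β] in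
lemma genBeta_mul_mem {x : ℚ⟮β⟯} (hx : (x : ℝ) ∈ Algebra.adjoin ℤ {β}) :
    ((genBeta β * x : ℚ⟮β⟯) : ℝ) ∈ Algebra.adjoin ℤ {β} :=
  mul_mem (S := Subalgebra ℤ ℝ) (Algebra.subset_adjoin rfl) hx

/-- The companion map sends `e_k` to `c e_0 + e_{k+1}` with an integer `c`, and `e_0` is the image
of `1`. So `βx - c` realizes `e_{k+1}` if `x` realizes `e_k`. With `exists_int_pisotL` this
identifies the image of `ℤ[β]` with `ℤ^d`. -/
lemma exists_pisotL_eq_single (k : ℕ) (hk : k < pisotDegree β) :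
    ∃ x : ℚ⟮β⟯, (x : ℝ) ∈ Algebra.adjoin ℤ {β} ∧
      pisotL β x = EuclideanSpace.single ⟨k, hk⟩ 1 := by
  induction k with
  | zero =>
    refine ⟨1, one_mem _, ?_⟩
    ext i
    rw [pisotL_one]
    simp [Fin.ext_iff]
  | succ k ih =>
    obtain ⟨x, hx, h⟩ := ih (by omega)
    set c := pisotCompanion β ⟨0, pisotDegree_pos β⟩ ⟨k, by omega⟩ with hc
    refine ⟨genBeta β * x - c • 1, ?_, ?_⟩
    · have : ((genBeta β * x - c • 1 : ℚ⟮β⟯) : ℝ) = ((genBeta β * x : ℚ⟮β⟯) : ℝ) - c • 1 := by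
        simp
      rw [this]
      exact sub_mem (genBeta_mul_mem β hx) (zsmul_mem (one_mem _) _)
    · rw [← pisotLHom_apply, map_sub, map_zsmul, pisotLHom_apply, pisotLHom_apply,
        pisotL_genBeta_mul, h]
      ext i
      have := companionMap_single β ⟨k, by omega⟩ hk i
      rw [← hc] at this
      simp only [WithLp.ofLp_sub, Pi.sub_apply, this, WithLp.ofLp_smul, Pi.smul_apply, pisotL_one]
      simp

lemma exists_pisotL_eq (z : Fin (pisotDegree β) → ℤ) :
    ∃ x : ℚ⟮β⟯, (x : ℝ) ∈ Algebra.adjoin ℤ {β} ∧ ∀ i, pisotL β x i = z i := by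
  choose y hy h using fun k : Fin (pisotDegree β) => exists_pisotL_eq_single β k k.2
  refine ⟨∑ k, z k • y k, ?_, fun i => ?_⟩
  · have : ((∑ k, z k • y k : ℚ⟮β⟯) : ℝ) = ∑ k, z k • (y k : ℝ) := by
      simp
    rw [this]
    exact sum_mem fun k _ => zsmul_mem (hy k) _
  · rw [← pisotLHom_apply, map_sum]
    simp only [map_zsmul, pisotLHom_apply, h, WithLp.ofLp_sum, Finset.sum_apply, WithLp.ofLp_smul,
      Pi.smul_apply]
    simp

lemma exists_int_pisotL {x : ℚ⟮β⟯} (hx : (x : ℝ) ∈ Algebra.adjoin ℤ {β}) :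
    ∃ z : Fin (pisotDegree β) → ℤ, ∀ i, pisotL β x i = z i := by
  rw [Algebra.adjoin_singleton_eq_range_aeval] at hx
  obtain ⟨p, hp⟩ := hx
  have hx : x = Polynomial.aeval (genBeta β) p := by
    apply Subtype.val_injective
    have := Polynomial.aeval_algHom_apply ((IntermediateField.val ℚ⟮β⟯).restrictScalars ℤ)
      (genBeta β) p
    rw [← hp]
    exact this
  rw [hx]
  clear hp hx
  induction p using Polynomial.induction_on with
  | C a =>
    refine ⟨fun i => a * (if (i : ℕ) = 0 then 1 else 0), fun i => ?_⟩
    have : Polynomial.aeval (genBeta β) (Polynomial.C a : Polynomial ℤ) = a • (1 : ℚ⟮β⟯) := by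
      simp
    rw [this, ← pisotLHom_apply, map_zsmul, pisotLHom_apply]
    simp [pisotL_one]
  | add p q hp hq =>
    obtain ⟨z, hz⟩ := hp
    obtain ⟨w, hw⟩ := hq
    refine ⟨z + w, fun i => ?_⟩
    rw [map_add, ← pisotLHom_apply, map_add, pisotLHom_apply, pisotLHom_apply]
    simp [hz, hw]
  | monomial n a ih =>
    obtain ⟨z, hz⟩ := ih
    refine ⟨fun i => ∑ j, pisotCompanion β i j * z j, fun i => ?_⟩
    rw [pow_succ, ← mul_assoc, map_mul, mul_comm, Polynomial.aeval_X, pisotL_genBeta_mul,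
      companionMap_apply]
    simp only [hz]
    push_cast
    rfl

/-- The decomposition of `ℝ^d` into the line `ℝ v₁` and the hyperplane `H`. -/
noncomputable def pisotSplit : (ℝ × pisotH β) ≃ₗ[ℝ] EuclideanSpace ℝ (Fin (pisotDegree β)) :=
  LinearEquiv.ofBijective
    ((LinearMap.toSpanSingleton ℝ _ (pisotV1 β)).coprod (pisotH β).subtype) <| by
    constructor
    · rw [← LinearMap.ker_eq_bot, LinearMap.ker_eq_bot']
      rintro ⟨s, h⟩ hs
      simp only [LinearMap.coprod_apply, LinearMap.toSpanSingleton_apply,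
        Submodule.subtype_apply] at hs
      have hs0 : s = 0 := by
        by_contra hne
        apply pisotV1_notMem β
        rw [← Submodule.smul_mem_iff _ hne, eq_neg_of_add_eq_zero_left hs]
        exact Submodule.neg_mem _ h.2
      rw [hs0, zero_smul, zero_add] at hs
      rw [hs0, Prod.mk_eq_zero]
      exact ⟨rfl, Subtype.val_injective hs⟩
    · rw [← LinearMap.range_eq_top, eq_top_iff,
        ← (EuclideanSpace.basisFun (Fin (pisotDegree β)) ℝ).toBasis.span_eq, Submodule.span_le]
      rintro _ ⟨k, rfl⟩
      obtain ⟨x, -, hx⟩ := exists_pisotL_eq_single β k k.2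
      refine ⟨(x, pisotPhi β x), ?_⟩
      simp only [OrthonormalBasis.coe_toBasis, EuclideanSpace.basisFun_apply]
      exact hx

lemma pisotSplit_apply (p : ℝ × pisotH β) : pisotSplit β p = p.1 • pisotV1 β + p.2 := rfl

lemma genBeta_ne_zero : genBeta β ≠ 0 := fun h => by
  have h1 : (1 : ℝ) < β := IsPisotUnit.one_lt
  have h2 : β = 0 := congrArg Subtype.val h
  linarith

/-- The minimal polynomial reads `q(β) β ± 1 = 0`, since its constant term is a unit. -/
lemma inv_mem_adjoin : β⁻¹ ∈ Algebra.adjoin ℤ {β} := by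
  have h1 : (1 : ℝ) < β := IsPisotUnit.one_lt
  have h := minpoly.aeval ℤ β
  rw [← Polynomial.divX_mul_X_add (minpoly ℤ β), map_add, map_mul, Polynomial.aeval_X,
    Polynomial.aeval_C] at h
  set q := Polynomial.aeval β (minpoly ℤ β).divX with hq
  have hqm : q ∈ Algebra.adjoin ℤ {β} := by
    rw [Algebra.adjoin_singleton_eq_range_aeval]
    exact ⟨_, rfl⟩
  simp only [eq_intCast] at h
  rcases Int.isUnit_iff.1 (IsPisotUnit.isUnit_coeff (β := β)) with hc | hc
  · rw [hc] at h
    have : β⁻¹ = -q := by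
      rw [eq_comm]
      refine eq_inv_of_mul_eq_one_left ?_
      push_cast at h
      linarith
    rw [this]
    exact neg_mem hqm
  · rw [hc] at h
    have : β⁻¹ = q := by
      rw [eq_comm]
      refine eq_inv_of_mul_eq_one_left ?_
      push_cast at h
      linarith
    rw [this]
    exact hqm

lemma genBeta_inv_mul_mem {x : ℚ⟮β⟯} (hx : (x : ℝ) ∈ Algebra.adjoin ℤ {β}) :
    (((genBeta β)⁻¹ * x : ℚ⟮β⟯) : ℝ) ∈ Algebra.adjoin ℤ {β} :=
  mul_mem (S := Subalgebra ℤ ℝ) (inv_mem_adjoin β) hx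

/-- The matrix is onto `ℤ^d`: if `z` is the image of `x ∈ ℤ[β]`, then the image of `β⁻¹ x ∈ ℤ[β]` is
a preimage of `z`. -/
lemma isUnit_det_pisotCompanion : IsUnit (pisotCompanion β).det := by
  rw [← Matrix.isUnit_iff_isUnit_det, ← Matrix.mulVec_surjective_iff_isUnit]
  intro z
  obtain ⟨x, hx, hz⟩ := exists_pisotL_eq β z
  obtain ⟨w, hw⟩ := exists_int_pisotL β (genBeta_inv_mul_mem β hx)
  refine ⟨w, funext fun i => ?_⟩
  have h := pisotL_genBeta_mul β ((genBeta β)⁻¹ * x)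
  rw [mul_inv_cancel_left₀ (genBeta_ne_zero β)] at h
  have := hz i
  rw [h, companionMap_apply] at this
  simp only [hw] at this
  simp only [Matrix.mulVec, dotProduct]
  exact_mod_cast this

lemma abs_det_companionMap : |LinearMap.det (companionMap β)| = 1 := by
  have h : LinearMap.det (companionMap β) = ((pisotCompanion β).det : ℝ) := by
    rw [companionMap, Matrix.toLpLin_eq_toLin, LinearMap.det_toLin]
    exact (RingHom.map_det (Int.castRingHom ℝ) (pisotCompanion β)).symm
  rw [h]
  rcases Int.isUnit_iff.1 (isUnit_det_pisotCompanion β) with h | h <;> simp [h]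

/-- In the splitting `ℝ v₁ ⊕ H` the companion map is `β ⊕ M`, and its determinant is `±1`. -/
lemma abs_det_pisotM : |LinearMap.det (pisotM β : pisotH β →ₗ[ℝ] pisotH β)| = β⁻¹ := by
  have h1 : (1 : ℝ) < β := IsPisotUnit.one_lt
  have hconj : companionMap β = (pisotSplit β : (ℝ × pisotH β) →ₗ[ℝ] _) ∘ₗ
      ((β • LinearMap.id : ℝ →ₗ[ℝ] ℝ).prodMap (pisotM β : pisotH β →ₗ[ℝ] pisotH β)) ∘ₗ
      ((pisotSplit β).symm : _ →ₗ[ℝ] (ℝ × pisotH β)) := by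
    refine LinearMap.ext fun u => ?_
    obtain ⟨p, rfl⟩ := (pisotSplit β).surjective u
    rw [LinearMap.comp_apply, LinearMap.comp_apply, LinearEquiv.coe_coe, LinearEquiv.coe_coe,
      LinearEquiv.symm_apply_apply, LinearMap.prodMap_apply, pisotSplit_apply, pisotSplit_apply,
      map_add, map_smul, companionMap_pisotV1, smul_smul, mul_comm]
    rfl
  have h := abs_det_companionMap β
  rw [hconj, LinearMap.det_conj, LinearMap.det_prodMap, LinearMap.det_smul, abs_mul] at h
  simp only [Module.finrank_self, pow_one, LinearMap.det_id, mul_one] at h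
  rw [abs_of_pos (by linarith)] at h
  exact eq_inv_of_mul_eq_one_right h

/-! ### The lattice -/

/-- The pairs `(x, Φ(x))`, `x ∈ ℤ[β]`, are relatively dense in `ℝ × H`. -/
lemma exists_lattice_point_near :
    ∃ R : ℝ, ∀ (s : ℝ) (h : pisotH β), ∃ x : ℚ⟮β⟯, (x : ℝ) ∈ Algebra.adjoin ℤ {β} ∧
      |(x : ℝ) - s| ≤ R ∧ ‖pisotPhi β x - h‖ ≤ R := by
  set Q := LinearMap.toContinuousLinearMap
    ((pisotSplit β).symm : EuclideanSpace ℝ (Fin (pisotDegree β)) →ₗ[ℝ] ℝ × pisotH β) with hQ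
  have hball : ∃ K, ∀ u : EuclideanSpace ℝ (Fin (pisotDegree β)), (∀ i, |u i| ≤ 1) → ‖u‖ ≤ K := by
    refine ⟨√(∑ _i : Fin (pisotDegree β), 1), fun u hu => ?_⟩
    rw [EuclideanSpace.norm_eq]
    refine Real.sqrt_le_sqrt (Finset.sum_le_sum fun i _ => ?_)
    have := hu i
    rw [Real.norm_eq_abs]
    exact pow_le_one₀ (abs_nonneg _) this
  obtain ⟨K, hK⟩ := hball
  refine ⟨‖Q‖ * K, fun s h => ?_⟩
  -- The lattice point is found by rounding the coordinates in `ℝ^d`.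
  obtain ⟨x, hx, hz⟩ := exists_pisotL_eq β fun i => round (pisotSplit β (s, h) i)
  have hd : ‖pisotL β x - pisotSplit β (s, h)‖ ≤ K := by
    refine hK _ fun i => ?_
    rw [WithLp.ofLp_sub, Pi.sub_apply, hz, abs_sub_comm]
    exact (abs_sub_round _).trans (by norm_num)
  have e : Q (pisotL β x - pisotSplit β (s, h)) = ((x : ℝ) - s, pisotPhi β x - h) := by
    change (pisotSplit β).symm _ = _
    rw [LinearEquiv.symm_apply_eq, pisotL, pisotSplit_apply, pisotSplit_apply]
    simp only [AddSubgroupClass.coe_sub]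
    module
  have hle : ‖((x : ℝ) - s, pisotPhi β x - h)‖ ≤ ‖Q‖ * K := by
    rw [← e]
    exact (Q.le_opNorm _).trans (by gcongr)
  exact ⟨x, hx, (norm_fst_le _).trans hle, (norm_snd_le _).trans hle⟩

/-- The pairs `(x, Φ(x))`, `x ∈ ℤ[β]`, are locally finite in `ℝ × H`. -/
lemma finite_lattice_points (R : ℝ) :
    {x : ℚ⟮β⟯ | (x : ℝ) ∈ Algebra.adjoin ℤ {β} ∧ |(x : ℝ)| ≤ R ∧ ‖pisotPhi β x‖ ≤ R}.Finite := by
  set K := R * ‖pisotV1 β‖ + R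
  have hfin : (Set.Icc (fun _ : Fin (pisotDegree β) => -⌈K⌉) (fun _ => ⌈K⌉)).Finite :=
    Set.finite_Icc _ _
  -- On `ℤ[β]` the coordinates are integers, so taking floors loses nothing and `F` is injective
  -- there.
  set F : ℚ⟮β⟯ → Fin (pisotDegree β) → ℤ := fun x i => ⌊pisotL β x i⌋
  refine Set.Finite.of_finite_image (f := F) (hfin.subset ?_) ?_
  · rintro _ ⟨x, ⟨hx, h1, h2⟩, rfl⟩
    obtain ⟨z, hz⟩ := exists_int_pisotL β hx
    have hF : F x = z := funext fun i => by simp only [F, hz, Int.floor_intCast]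
    have hb : ∀ i, |(z i : ℝ)| ≤ K := by
      intro i
      rw [← hz, ← Real.norm_eq_abs]
      refine (PiLp.norm_apply_le _ i).trans ((norm_add_le _ _).trans ?_)
      rw [norm_smul, Real.norm_eq_abs]
      exact add_le_add (by gcongr) h2
    rw [hF, Set.mem_Icc, Pi.le_def, Pi.le_def]
    refine ⟨fun i => ?_, fun i => ?_⟩
    · have := (abs_le.1 ((hb i).trans (Int.le_ceil K))).1
      exact_mod_cast this
    · have := (abs_le.1 ((hb i).trans (Int.le_ceil K))).2
      exact_mod_cast this
  · rintro x ⟨hx, -⟩ y ⟨hy, -⟩ h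
    obtain ⟨z, hz⟩ := exists_int_pisotL β hx
    obtain ⟨w, hw⟩ := exists_int_pisotL β hy
    have hzw : z = w := by
      have hFx : F x = z := funext fun i => by simp only [F, hz, Int.floor_intCast]
      have hFy : F y = w := funext fun i => by simp only [F, hw, Int.floor_intCast]
      rw [← hFx, ← hFy, h]
    rw [← sub_eq_zero]
    apply pisotL_eq_zero β
    rw [← pisotLHom_apply, map_sub, sub_eq_zero, pisotLHom_apply, pisotLHom_apply]
    ext i
    rw [hz, hw, hzw]

end Companion

/-! ### Backward orbits in a finite set, and affine branches -/

open Filter Topology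

/-- Let `B` be a finite set such that every point of `B` has an `f`-preimage in `B ∪ G`. Then a
point of `B` either has a forward orbit in `B`, or it is in the forward orbit of a point of `G`. -/
lemma iterate_mem_or_exists_iterate_eq {α : Type*} {f : α → α} {B G : Set α} (hB : B.Finite)
    (hpre : ∀ b ∈ B, ∃ b' ∈ B ∪ G, f b' = b) {z : α} (hz : z ∈ B) :
    (∀ n, f^[n] z ∈ B) ∨ ∃ g ∈ G, ∃ j, f^[j] g = z := by
  by_contra! hcon
  obtain ⟨⟨n, hn⟩, hG⟩ := hcon
  -- If no point of `G` reaches `z`, preimages can be chosen in `B` forever. By finiteness this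
  -- backward chain repeats, so `z` lies on a cycle contained in the chain, hence in `B`.
  have step : ∀ b : {b // b ∈ B ∧ ∃ j, f^[j] b = z},
      ∃ b' : {b // b ∈ B ∧ ∃ j, f^[j] b = z}, f b' = b := by
    rintro ⟨b, hb, j, hj⟩
    obtain ⟨b', hb' | hb', h⟩ := hpre b hb
    · exact ⟨⟨b', hb', j + 1, by rw [Function.iterate_succ_apply, h, hj]⟩, h⟩
    · exact absurd (by rw [Function.iterate_succ_apply, h, hj]) (hG b' hb' (j + 1))
  choose F hF using step
  set z0 : {b // b ∈ B ∧ ∃ j, f^[j] b = z} := ⟨z, hz, 0, rfl⟩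
  set c : ℕ → α := fun i => (F^[i] z0 : α) with hc
  have hcB : ∀ i, c i ∈ B := fun i => (F^[i] z0).2.1
  have hcs : ∀ i, f (c (i + 1)) = c i := fun i => by
    simp only [hc, Function.iterate_succ_apply', hF]
  have hback : ∀ k i, f^[k] (c (i + k)) = c i := by
    intro k
    induction k with
    | zero => simp
    | succ k ih => intro i; rw [Function.iterate_succ_apply, ← add_assoc, hcs, ih]
  have hex : ∃ i p, 0 < p ∧ c i = c (i + p) := by
    obtain ⟨a, b, hab, h⟩ := hB.exists_lt_map_eq_of_forall_mem hcB
    exact ⟨a, b - a, by omega, by rw [h]; congr 1; omega⟩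
  obtain ⟨i, p, hp, hip⟩ := hex
  have hper : Function.IsPeriodicPt f p (c i) := by
    have := hback p i
    rwa [← hip] at this
  have hz0 : f^[i] (c i) = z := by
    have := hback i 0
    rwa [zero_add] at this
  apply hn
  rw [← hz0, ← Function.iterate_add_apply, ← hper.iterate_mod_apply]
  have hr := Nat.mod_lt (n + i) hp
  have := hback ((n + i) % p) (i + p - (n + i) % p)
  rw [Nat.sub_add_cancel (by omega), ← hip] at this
  rw [this]
  exact hcB _

lemma tendsto_affine_right {β : ℝ} (hβ : 0 < β) (a z : ℝ) :
    Tendsto (fun r => β * r - a) (𝓝[>] z) (𝓝[>] (β * z - a)) := by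
  refine tendsto_nhdsWithin_of_tendsto_nhds_of_eventually_within _ ?_ ?_
  · exact (Continuous.tendsto (by fun_prop) z).mono_left nhdsWithin_le_nhds
  · filter_upwards [self_mem_nhdsWithin] with r hr
    exact sub_lt_sub_right (mul_lt_mul_of_pos_left (Set.mem_Ioi.1 hr) hβ) _

lemma tendsto_affine_left {β : ℝ} (hβ : 0 < β) (a z : ℝ) :
    Tendsto (fun r => β * r - a) (𝓝[<] z) (𝓝[<] (β * z - a)) := by
  refine tendsto_nhdsWithin_of_tendsto_nhds_of_eventually_within _ ?_ ?_
  · exact (Continuous.tendsto (by fun_prop) z).mono_left nhdsWithin_le_nhds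
  · filter_upwards [self_mem_nhdsWithin] with r hr
    exact sub_lt_sub_right (mul_lt_mul_of_pos_left (Set.mem_Iio.1 hr) hβ) _

namespace RightContBetaTransformation

variable {β : ℝ} (T : RightContBetaTransformation β)

lemma beta_pos (T : RightContBetaTransformation β) : 0 < β := zero_lt_one.trans T.one_lt

/-! ### One-sided limits -/

lemma eventually_mem_piece_right {a z : ℝ} (hz : z ∈ T.piece a) :
    ∀ᶠ s in 𝓝[>] z, s ∈ T.piece a := by
  simp only [piece, Set.mem_iUnion] at hz ⊢
  obtain ⟨p, hp, h1, h2⟩ := hz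
  filter_upwards [Ioo_mem_nhdsGT h2] with s hs
  exact ⟨p, hp, h1.trans hs.1.le, hs.2⟩

lemma eventually_notMem_piece_right {a z : ℝ} (hz : z ∉ T.piece a) :
    ∀ᶠ s in 𝓝[>] z, s ∉ T.piece a := by
  simp only [piece, Set.mem_iUnion, not_exists] at hz ⊢
  have : ∀ᶠ s in 𝓝[>] z, ∀ p ∈ T.intervals a, s ∉ Set.Ico p.1 p.2 := by
    rw [Finset.eventually_all]
    intro p hp
    rcases lt_or_ge z p.1 with h | h
    · filter_upwards [Ioo_mem_nhdsGT h] with s hs h'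
      exact absurd h'.1 (not_le.2 hs.2)
    · have h2 : p.2 ≤ z := not_lt.1 fun h2 => hz p hp ⟨h, h2⟩
      filter_upwards [self_mem_nhdsWithin] with s hs h'
      exact absurd h'.2 (not_lt.2 (h2.trans (le_of_lt hs)))
  exact this

lemma eventually_mem_piece_left {a z : ℝ} (hz : z ∈ T.leftPiece a) :
    ∀ᶠ s in 𝓝[<] z, s ∈ T.piece a := by
  simp only [piece, leftPiece, Set.mem_iUnion] at hz ⊢
  obtain ⟨p, hp, h1, h2⟩ := hz
  filter_upwards [Ioo_mem_nhdsLT h1] with s hs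
  exact ⟨p, hp, hs.1.le, hs.2.trans_le h2⟩

lemma eventually_notMem_piece_left {a z : ℝ} (hz : z ∉ T.leftPiece a) :
    ∀ᶠ s in 𝓝[<] z, s ∉ T.piece a := by
  simp only [piece, leftPiece, Set.mem_iUnion, not_exists] at hz ⊢
  have : ∀ᶠ s in 𝓝[<] z, ∀ p ∈ T.intervals a, s ∉ Set.Ico p.1 p.2 := by
    rw [Finset.eventually_all]
    intro p hp
    rcases lt_or_ge p.2 z with h | h
    · filter_upwards [Ioo_mem_nhdsLT h] with s hs h'
      exact absurd h'.2 (not_lt.2 hs.1.le)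
    · have h2 : z ≤ p.1 := not_lt.1 fun h2 => hz p hp ⟨h2, h⟩
      filter_upwards [self_mem_nhdsWithin] with s hs h'
      exact absurd h'.1 (not_le.2 (lt_of_lt_of_le hs h2))
  exact this

lemma mem_X {z : ℝ} : z ∈ T.X ↔ ∃ a ∈ T.digits, z ∈ T.piece a := by simp [X]

lemma mem_leftX {z : ℝ} : z ∈ T.leftX ↔ ∃ a ∈ T.digits, z ∈ T.leftPiece a := by simp [leftX]

lemma eventually_mem_X_right {z : ℝ} (hz : z ∈ T.X) : ∀ᶠ s in 𝓝[>] z, s ∈ T.X := by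
  obtain ⟨a, ha, h⟩ := T.mem_X.1 hz
  filter_upwards [T.eventually_mem_piece_right h] with s hs
  exact T.mem_X.2 ⟨a, ha, hs⟩

lemma eventually_mem_X_left {z : ℝ} (hz : z ∈ T.leftX) : ∀ᶠ s in 𝓝[<] z, s ∈ T.X := by
  obtain ⟨a, ha, h⟩ := T.mem_leftX.1 hz
  filter_upwards [T.eventually_mem_piece_left h] with s hs
  exact T.mem_X.2 ⟨a, ha, hs⟩

lemma eventually_notMem_X_right {z : ℝ} (hz : z ∉ T.X) : ∀ᶠ s in 𝓝[>] z, s ∉ T.X := by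
  have : ∀ᶠ s in 𝓝[>] z, ∀ a ∈ T.digits, s ∉ T.piece a :=
    T.digits.eventually_all.2 fun a ha =>
      T.eventually_notMem_piece_right fun h => hz (T.mem_X.2 ⟨a, ha, h⟩)
  filter_upwards [this] with s hs h
  obtain ⟨a, ha, h⟩ := T.mem_X.1 h
  exact hs a ha h

lemma eventually_notMem_X_left {z : ℝ} (hz : z ∉ T.leftX) : ∀ᶠ s in 𝓝[<] z, s ∉ T.X := by
  have : ∀ᶠ s in 𝓝[<] z, ∀ a ∈ T.digits, s ∉ T.piece a :=
    T.digits.eventually_all.2 fun a ha =>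
      T.eventually_notMem_piece_left fun h => hz (T.mem_leftX.2 ⟨a, ha, h⟩)
  filter_upwards [this] with s hs h
  obtain ⟨a, ha, h⟩ := T.mem_X.1 h
  exact hs a ha h

lemma map_eq {a x : ℝ} (ha : a ∈ T.digits) (hx : x ∈ T.piece a) : T.map x = β * x - a := by
  rw [map, T.digit_eq ha hx]

lemma leftMap_eq {a x : ℝ} (ha : a ∈ T.digits) (hx : x ∈ T.leftPiece a) :
    T.leftMap x = β * x - a := by
  rw [leftMap, leftDigit, Finset.sum_eq_single a, Set.indicator_of_mem hx]
  · intro b hb hba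
    refine Set.indicator_of_notMem (fun h => ?_) _
    -- A common point of two left pieces would have points of both right pieces just to its left.
    obtain ⟨s, h1, h2⟩ :=
      ((T.eventually_mem_piece_left hx).and (T.eventually_mem_piece_left h)).exists
    exact Set.disjoint_left.mp (T.disjoint b hb a ha hba) h2 h1
  · exact fun h => absurd ha h

lemma digit_mem {x : ℝ} (hx : x ∈ T.X) : T.digit x ∈ T.digits ∧ x ∈ T.piece (T.digit x) := by
  obtain ⟨a, ha, h⟩ := T.mem_X.1 hx
  rw [T.digit_eq ha h]
  exact ⟨ha, h⟩

lemma map_mem {x : ℝ} (hx : x ∈ T.X) : T.map x ∈ T.X := by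
  obtain ⟨a, ha, h⟩ := T.mem_X.1 hx
  rw [T.map_eq ha h]
  have := T.surjective.subset (Set.mem_biUnion ha (Set.mem_image_of_mem (fun x => β * x - a) h))
  exact this

lemma exists_map_eq {x : ℝ} (hx : x ∈ T.X) : ∃ y ∈ T.X, T.map y = x := by
  have := T.surjective.symm.subset hx
  simp only [Set.mem_iUnion] at this
  obtain ⟨a, ha, y, hy, h⟩ := this
  have hy' : y ∈ T.piece a := by simpa [piece] using hy
  exact ⟨y, T.mem_X.2 ⟨a, ha, hy'⟩, (T.map_eq ha hy').trans h⟩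

lemma leftMap_mem {x : ℝ} (hx : x ∈ T.leftX) : T.leftMap x ∈ T.leftX := by
  obtain ⟨a, ha, h⟩ := T.mem_leftX.1 hx
  by_contra hcon
  rw [T.leftMap_eq ha h] at hcon
  obtain ⟨s, h1, h2⟩ := ((T.eventually_mem_piece_left h).and
    ((tendsto_affine_left T.beta_pos a x).eventually (T.eventually_notMem_X_left hcon))).exists
  rw [← T.map_eq ha h1] at h2
  exact h2 (T.map_mem (T.mem_X.2 ⟨a, ha, h1⟩))

/-- If all candidate preimages missed the left pieces, then points just to the left of `x` would
have no `T`-preimage either, contradicting surjectivity of `T`. -/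
lemma exists_leftMap_eq {x : ℝ} (hx : x ∈ T.leftX) : ∃ y ∈ T.leftX, T.leftMap y = x := by
  by_contra! hcon
  have hb := T.beta_pos
  have h1 : ∀ a ∈ T.digits, (x + a) / β ∉ T.leftPiece a := fun a ha h =>
    hcon _ (T.mem_leftX.2 ⟨a, ha, h⟩) (by rw [T.leftMap_eq ha h]; field_simp; ring)
  have h2 : ∀ᶠ s in 𝓝[<] x, ∀ a ∈ T.digits, (s + a) / β ∉ T.piece a := by
    rw [Finset.eventually_all]
    intro a ha
    refine Tendsto.eventually (f := fun s => (s + a) / β) (p := fun s => s ∉ T.piece a) ?_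
      (T.eventually_notMem_piece_left (h1 a ha))
    refine tendsto_nhdsWithin_of_tendsto_nhds_of_eventually_within _ ?_ ?_
    · exact (Continuous.tendsto (by fun_prop) x).mono_left nhdsWithin_le_nhds
    · filter_upwards [self_mem_nhdsWithin] with r hr
      have : r < x := hr
      change (r + a) / β < (x + a) / β
      gcongr
  obtain ⟨s, hs1, hs2⟩ := (h2.and (T.eventually_mem_X_left hx)).exists
  obtain ⟨y, hy, rfl⟩ := T.exists_map_eq hs2
  obtain ⟨ha, hya⟩ := T.digit_mem hy
  refine hs1 _ ha ?_
  rw [map, sub_add_cancel, mul_div_cancel_left₀ _ hb.ne']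
  exact hya

lemma iterate_map_mem {x : ℝ} (hx : x ∈ T.X) (n : ℕ) : T.map^[n] x ∈ T.X :=
  (Set.MapsTo.iterate (fun _ => T.map_mem) n : Set.MapsTo _ T.X T.X) hx

lemma iterate_leftMap_mem {x : ℝ} (hx : x ∈ T.leftX) (n : ℕ) : T.leftMap^[n] x ∈ T.leftX :=
  (Set.MapsTo.iterate (fun _ => T.leftMap_mem) n : Set.MapsTo _ T.leftX T.leftX) hx

lemma eventually_iterate_right (n : ℕ) {s : ℝ} (hs : s ∈ T.X) :
    ∀ᶠ r in 𝓝[>] s, T.map^[n] r = T.map^[n] s + β ^ n * (r - s) := by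
  induction n generalizing s with
  | zero => simp
  | succ n ih =>
    obtain ⟨a, ha, h⟩ := T.mem_X.1 hs
    have := ih (T.map_mem hs)
    rw [T.map_eq ha h] at this
    filter_upwards [T.eventually_mem_piece_right h, (tendsto_affine_right T.beta_pos a s).eventually this]
      with r h1 h2
    rw [Function.iterate_succ_apply, Function.iterate_succ_apply, T.map_eq ha h1, h2,
      T.map_eq ha h]
    ring

lemma eventually_iterate_left (n : ℕ) {s : ℝ} (hs : s ∈ T.leftX) :
    ∀ᶠ r in 𝓝[<] s, T.map^[n] r = T.leftMap^[n] s + β ^ n * (r - s) := by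
  induction n generalizing s with
  | zero => simp
  | succ n ih =>
    obtain ⟨a, ha, h⟩ := T.mem_leftX.1 hs
    have := ih (T.leftMap_mem hs)
    rw [T.leftMap_eq ha h] at this
    filter_upwards [T.eventually_mem_piece_left h, (tendsto_affine_left T.beta_pos a s).eventually this]
      with r h1 h2
    rw [Function.iterate_succ_apply, Function.iterate_succ_apply, T.map_eq ha h1, h2,
      T.leftMap_eq ha h]
    ring

lemma finite_leftX_diff_X : (T.leftX \ T.X).Finite := by
  refine (T.digits.finite_toSet.biUnion fun a _ =>
    ((T.intervals a).finite_toSet.image Prod.snd)).subset ?_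
  rintro z ⟨h1, h2⟩
  obtain ⟨a, ha, h⟩ := T.mem_leftX.1 h1
  simp only [leftPiece, Set.mem_iUnion] at h
  obtain ⟨p, hp, h3, h4⟩ := h
  refine Set.mem_biUnion ha ⟨p, hp, ?_⟩
  by_contra hne
  refine h2 (T.mem_X.2 ⟨a, ha, ?_⟩)
  simp only [piece, Set.mem_iUnion]
  exact ⟨p, hp, h3.le, lt_of_le_of_ne h4 (Ne.symm hne)⟩

lemma diff_subset_V : T.X \ T.leftX ⊆ T.V := Set.subset_union_left

/-! ### Merging of the right- and left-continuous orbits -/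

lemma mem_V_of_ne {s : ℝ} (hs : s ∈ T.X ∩ T.leftX) {N : ℕ} (hN : 1 ≤ N)
    (hne : ∀ n, 1 ≤ n → n ≤ N → T.leftMap^[n] s ≠ T.map^[n] s) :
    ({T.map^[N] s, T.leftMap^[N] s} ∩ T.X) ⊆ T.V := by
  have : (N : ℕ∞) < T.mergeTime s := by
    have h : ((N + 1 : ℕ) : ℕ∞) ≤ T.mergeTime s := by
      refine le_sInf ?_
      rintro _ ⟨n, rfl, hn1, hn⟩
      have : N + 1 ≤ n := by
        by_contra hlt
        exact hne n hn1 (by omega) hn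
      exact_mod_cast this
    refine lt_of_lt_of_le ?_ h
    exact_mod_cast Nat.lt_succ_self N
  intro t ht
  refine Or.inr (Set.mem_biUnion hs ?_)
  exact Set.mem_biUnion (show N ∈ {k : ℕ | 1 ≤ k ∧ (k : ℕ∞) < T.mergeTime s} from ⟨hN, this⟩) ht

/-- If the two orbits meet at some time `n` with `1 ≤ n ≤ N`, the argument restarts from the common
value, which lies in `X ∩ X̃`. If they never meet up to time `N`, then `N < m_s` and `t` would
belong to `𝒱`. -/
lemma iterate_eq_of_notMem_V (N : ℕ) {s t : ℝ} (hs : s ∈ T.X ∩ T.leftX)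
    (ht : t = T.map^[N] s ∨ t = T.leftMap^[N] s) (htX : t ∈ T.X) (htV : t ∉ T.V) :
    T.map^[N] s = T.leftMap^[N] s := by
  induction N using Nat.strong_induction_on generalizing s with
  | _ N ih =>
    rcases Nat.eq_zero_or_pos N with rfl | hN
    · rfl
    by_cases hex : ∃ n, 1 ≤ n ∧ n ≤ N ∧ T.leftMap^[n] s = T.map^[n] s
    · obtain ⟨n, h1, h2, h3⟩ := hex
      have hsplit : N = (N - n) + n := by omega
      have hu : T.map^[n] s ∈ T.X ∩ T.leftX :=
        ⟨T.iterate_map_mem hs.1 n, h3 ▸ T.iterate_leftMap_mem hs.2 n⟩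
      rw [hsplit, Function.iterate_add_apply, Function.iterate_add_apply, h3] at ht ⊢
      exact ih (N - n) (by omega) hu ht
    · push Not at hex
      exact absurd (T.mem_V_of_ne hs hN hex ⟨ht, htX⟩) htV

/-- On an interval in `X`, the map `T^N` coincides with the affine map `s ↦ β^N s + c` everywhere
as soon as it does so in one point, provided that the affine map avoids `𝒱`. -/
lemma iterate_eq_affine {u u' c : ℝ} {N : ℕ} (hX : Set.Icc u u' ⊆ T.X)
    (hc : ∀ s ∈ Set.Ioc u u', β ^ N * s + c ∈ T.X \ T.V) {s₀ : ℝ} (hs₀ : s₀ ∈ Set.Icc u u')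
    (h₀ : T.map^[N] s₀ = β ^ N * s₀ + c) {s : ℝ} (hs : s ∈ Set.Icc u u') :
    T.map^[N] s = β ^ N * s + c := by
  set P : ℝ → Prop := fun s => T.map^[N] s = β ^ N * s + c
  -- The property `P` is locally constant on the interval, so connectedness propagates it. From the
  -- right this is right-continuity; from the left, `T^N` and `T̃^N` agree at `s` once either takes
  -- the affine value, since that value lies in `X \ 𝒱`.
  have hloc : ∀ s ∈ Set.Icc u u', ∀ᶠ r in 𝓝[Set.Icc u u'] s, (P r ↔ P s) := by
    intro s hs
    have hright : ∀ᶠ r in 𝓝[>] s, (P r ↔ P s) := by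
      filter_upwards [T.eventually_iterate_right N (hX hs)] with r hr
      simp only [P, hr]
      constructor <;> intro h <;> linarith
    have hleft : u < s → ∀ᶠ r in 𝓝[<] s, (P r ↔ P s) := by
      intro hus
      have hsl : s ∈ T.leftX := by
        by_contra hcon
        obtain ⟨r, h1, h2⟩ := ((T.eventually_notMem_X_left hcon).and (Ioo_mem_nhdsLT hus)).exists
        exact h1 (hX ⟨h2.1.le, h2.2.le.trans hs.2⟩)
      have hcs := hc s ⟨hus, hs.2⟩
      have hPs : P s ↔ T.leftMap^[N] s = β ^ N * s + c := by
        constructor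
        · intro h
          rw [← T.iterate_eq_of_notMem_V N ⟨hX hs, hsl⟩ (Or.inl h.symm) hcs.1 hcs.2, h]
        · intro h
          exact (T.iterate_eq_of_notMem_V N ⟨hX hs, hsl⟩ (Or.inr h.symm) hcs.1 hcs.2).trans h
      filter_upwards [T.eventually_iterate_left N hsl] with r hr
      rw [hPs]
      simp only [P, hr]
      constructor <;> intro h <;> linarith
    rcases hs.1.eq_or_lt with h | h
    · have : ∀ᶠ r in 𝓝[≥] s, (P r ↔ P s) := by
        rw [← Set.Ioi_insert, nhdsWithin_insert, eventually_sup]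
        exact ⟨by simp, hright⟩
      refine this.filter_mono (nhdsWithin_mono _ ?_)
      rw [← h]
      exact Set.Icc_subset_Ici_self
    · refine Eventually.filter_mono nhdsWithin_le_nhds ?_
      rw [← nhdsLT_sup_nhdsGE, ← Set.Ioi_insert, nhdsWithin_insert, eventually_sup, eventually_sup]
      exact ⟨hleft h, by simp, hright⟩
  have hiff := isPreconnected_Icc.induction₂ (fun s r => (P s ↔ P r))
    (fun s hs => (hloc s hs).mono fun r hr => hr.symm)
    (fun _ _ _ _ _ _ h h' => h.trans h') (fun _ _ _ _ h => h.symm) hs₀ hs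
  exact hiff.1 h₀

/-! ### Exits from the domain -/

/-- The infimum of the points outside `X` is itself outside, because `X` is open to the right; it is
a limit of points of `X` from the left. -/
lemma exists_exit {y y' : ℝ} (hy : y ∈ T.X) (hX : ¬ Set.Icc y y' ⊆ T.X) :
    ∃ z ∈ Set.Ioc y y', z ∈ T.leftX \ T.X ∧ Set.Ico y z ⊆ T.X := by
  set S := {s ∈ Set.Icc y y' | s ∉ T.X}
  obtain ⟨s, hs, hsX⟩ := Set.not_subset.1 hX
  have hne : S.Nonempty := ⟨s, hs, hsX⟩
  have hbdd : BddBelow S := ⟨y, fun r hr => hr.1.1⟩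
  set z := sInf S
  have hzy : y ≤ z := le_csInf hne fun r hr => hr.1.1
  have hzs : z ≤ s := csInf_le hbdd ⟨hs, hsX⟩
  have hIco : Set.Ico y z ⊆ T.X := fun r hr => by
    by_contra hcon
    exact (notMem_of_lt_csInf hr.2 hbdd) ⟨⟨hr.1, hr.2.le.trans (hzs.trans hs.2)⟩, hcon⟩
  have hzX : z ∉ T.X := fun hz => by
    have h1 := T.eventually_mem_X_right hz
    rw [eventually_nhdsWithin_iff, Metric.eventually_nhds_iff] at h1
    obtain ⟨ε, hε, h⟩ := h1
    obtain ⟨r, hr, hlt⟩ := exists_lt_of_csInf_lt hne (show sInf S < z + ε by linarith)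
    have hzr : z ≤ r := csInf_le hbdd hr
    rcases hzr.eq_or_lt with h2 | h2
    · exact hr.2 (h2 ▸ hz)
    · exact hr.2 (h (by rw [Real.dist_eq, abs_of_pos (by linarith)]; linarith) h2)
  have hlt : y < z := lt_of_le_of_ne hzy fun h => hzX (h ▸ hy)
  refine ⟨z, ⟨hlt, hzs.trans hs.2⟩, ⟨?_, hzX⟩, hIco⟩
  by_contra hcon
  obtain ⟨r, h1, h2⟩ := ((T.eventually_notMem_X_left hcon).and (Ioo_mem_nhdsLT hlt)).exists
  exact h1 (hIco ⟨h2.1.le, h2.2⟩)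

lemma exists_entry {y y' : ℝ} (hy' : y' ∈ T.X) (hX : ¬ Set.Icc y y' ⊆ T.X) :
    ∃ z ∈ Set.Ioc y y', z ∈ T.X \ T.leftX ∧ Set.Icc z y' ⊆ T.X := by
  set S := {s ∈ Set.Icc y y' | s ∉ T.X}
  obtain ⟨s, hs, hsX⟩ := Set.not_subset.1 hX
  have hne : S.Nonempty := ⟨s, hs, hsX⟩
  have hbdd : BddAbove S := ⟨y', fun r hr => hr.1.2⟩
  set z := sSup S
  have hzy : z ≤ y' := csSup_le hne fun r hr => hr.1.2
  have hzs : s ≤ z := le_csSup hbdd ⟨hs, hsX⟩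
  have hIoc : Set.Ioc z y' ⊆ T.X := fun r hr => by
    by_contra hcon
    exact (notMem_of_csSup_lt hr.1 hbdd) ⟨⟨(hs.1.trans hzs).trans hr.1.le, hr.2⟩, hcon⟩
  have hzX : z ∈ T.X := by
    by_contra hcon
    rcases hzy.eq_or_lt with h | h
    · exact hcon (h ▸ hy')
    · obtain ⟨r, h1, h2⟩ := ((T.eventually_notMem_X_right hcon).and (Ioo_mem_nhdsGT h)).exists
      exact h1 (hIoc ⟨h2.1, h2.2.le⟩)
  have hsz : s < z := lt_of_le_of_ne hzs fun h => hsX (h ▸ hzX)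
  refine ⟨z, ⟨hs.1.trans_lt hsz, hzy⟩, ⟨hzX, fun hz => ?_⟩, fun r hr => ?_⟩
  · have h1 := T.eventually_mem_X_left hz
    rw [eventually_nhdsWithin_iff, Metric.eventually_nhds_iff] at h1
    obtain ⟨ε, hε, h⟩ := h1
    obtain ⟨r, hr, hlt⟩ := exists_lt_of_lt_csSup hne (show z - ε < sSup S by linarith)
    have hzr : r ≤ z := le_csSup hbdd hr
    rcases hzr.eq_or_lt with h2 | h2
    · exact hr.2 (h2 ▸ hzX)
    · exact hr.2 (h (by rw [dist_comm, Real.dist_eq, abs_of_pos (by linarith)]; linarith) h2)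
  · rcases hr.1.eq_or_lt with h | h
    · exact h ▸ hzX
    · exact hIoc ⟨h, hr.2⟩

/-- A gap before `x'` would end at a point of `X \ X̃`, which is part of `𝒱`. -/
lemma Icc_subset_X {x x' : ℝ} (hx' : x' ∈ T.X) (hV : ∀ t ∈ Set.Ioc x x', t ∉ T.V) :
    Set.Icc x x' ⊆ T.X := by
  by_contra hcon
  obtain ⟨z, hz, h, -⟩ := T.exists_entry hx' hcon
  exact hV z hz (T.diff_subset_V h)

/-! ### Jumps over the gaps of the domain -/

lemma sub_iterate_map_mem (hA : ∀ a ∈ T.digits, a ∈ Algebra.adjoin ℤ {β}) (n : ℕ) {y : ℝ}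
    (hy : y ∈ T.X) : β ^ n * y - T.map^[n] y ∈ Algebra.adjoin ℤ {β} := by
  induction n generalizing y with
  | zero => simp
  | succ n ih =>
    obtain ⟨a, ha, h⟩ := T.mem_X.1 hy
    have h1 := ih (T.map_mem hy)
    have hβ : β ∈ Algebra.adjoin ℤ {β} := Algebra.subset_adjoin rfl
    have h2 := add_mem h1 (mul_mem (pow_mem hβ n) (hA a ha))
    rw [Function.iterate_succ_apply]
    convert h2 using 1
    rw [T.map_eq ha h]
    ring

lemma sub_iterate_leftMap_mem (hA : ∀ a ∈ T.digits, a ∈ Algebra.adjoin ℤ {β}) (n : ℕ) {y : ℝ}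
    (hy : y ∈ T.leftX) : β ^ n * y - T.leftMap^[n] y ∈ Algebra.adjoin ℤ {β} := by
  induction n generalizing y with
  | zero => simp
  | succ n ih =>
    obtain ⟨a, ha, h⟩ := T.mem_leftX.1 hy
    have h1 := ih (T.leftMap_mem hy)
    have hβ : β ∈ Algebra.adjoin ℤ {β} := Algebra.subset_adjoin rfl
    have h2 := add_mem h1 (mul_mem (pow_mem hβ n) (hA a ha))
    rw [Function.iterate_succ_apply]
    convert h2 using 1
    rw [T.leftMap_eq ha h]
    ring

lemma sub_iterate_mem (hA : ∀ a ∈ T.digits, a ∈ Algebra.adjoin ℤ {β}) (n : ℕ) {y : ℝ}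
    (hy : y ∈ T.X ∩ T.leftX) : T.map^[n] y - T.leftMap^[n] y ∈ Algebra.adjoin ℤ {β} := by
  have := sub_mem (T.sub_iterate_leftMap_mem hA n hy.2) (T.sub_iterate_map_mem hA n hy.1)
  rwa [sub_sub_sub_cancel_left] at this

/-- From a right end `z ∉ X` of the domain, one can jump to a point of the domain with the same
future, as long as the left-continuous orbit of `z` arrives in `X \ 𝒱`. -/
lemma exists_jump_right (hA : ∀ a ∈ T.digits, a ∈ Algebra.adjoin ℤ {β}) {z : ℝ}
    (hz : z ∈ T.leftX \ T.X) :
    ∃ b ∈ Algebra.adjoin ℤ {β}, ∃ ε > 0, ∀ N, T.leftMap^[N] z ∈ T.X \ T.V →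
      Set.Icc (z + b) (z + b + ε) ⊆ T.X ∧ T.map^[N] (z + b) = T.leftMap^[N] z := by
  have hpre : ∀ b ∈ T.leftX \ T.X, ∃ b' ∈ (T.leftX \ T.X) ∪ (T.X ∩ T.leftX),
      T.leftMap b' = b := by
    intro b hb
    obtain ⟨b', hb', h⟩ := T.exists_leftMap_eq hb.1
    refine ⟨b', ?_, h⟩
    by_cases hX : b' ∈ T.X
    · exact Or.inr ⟨hX, hb'⟩
    · exact Or.inl ⟨hb', hX⟩
  rcases iterate_mem_or_exists_iterate_eq T.finite_leftX_diff_X hpre hz with h | ⟨g, hg, j, rfl⟩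
  -- The left orbit of `z` never enters `X`, so the condition on `N` is never met and the data are
  -- irrelevant.
  · exact ⟨0, zero_mem _, 1, one_pos, fun N hN => absurd hN.1 (h N).2⟩
  · have hX := T.iterate_map_mem hg.1 j
    have h1 := T.eventually_mem_X_right hX
    rw [eventually_iff, mem_nhdsGT_iff_exists_Ioc_subset] at h1
    obtain ⟨r, hr, hsub⟩ := h1
    rw [Set.mem_Ioi] at hr
    -- Here `z = T̃^j g` with `g ∈ X ∩ X̃`, and the jump leads to `T^j g`. The two continuations of
    -- `g` agree whenever they arrive in `X \ 𝒱`.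
    refine ⟨T.map^[j] g - T.leftMap^[j] g, T.sub_iterate_mem hA j hg, r - T.map^[j] g,
      sub_pos.2 hr, fun N hN => ⟨?_, ?_⟩⟩
    · rw [add_sub_cancel, add_sub_cancel]
      intro s hs
      rcases hs.1.eq_or_lt with h | h
      · exact h ▸ hX
      · exact hsub ⟨h, hs.2⟩
    · rw [← Function.iterate_add_apply] at hN ⊢
      rw [add_sub_cancel, ← Function.iterate_add_apply]
      exact T.iterate_eq_of_notMem_V _ hg (Or.inr rfl) hN.1 hN.2

/-- From a left end `z` of the domain, one can jump to a point of `X̃` with the same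
future, as long as the orbit of `z` arrives outside `𝒱`. -/
lemma exists_jump_left (hA : ∀ a ∈ T.digits, a ∈ Algebra.adjoin ℤ {β}) (hV : T.V.Finite) {z : ℝ}
    (hz : z ∈ T.X \ T.leftX) :
    ∃ b ∈ Algebra.adjoin ℤ {β}, ∃ ε > 0, ∀ N, T.map^[N] z ∈ T.X \ T.V →
      Set.Ico (z + b - ε) (z + b) ⊆ T.X ∧ z + b ∈ T.leftX ∧
        T.leftMap^[N] (z + b) = T.map^[N] z := by
  have hpre : ∀ b ∈ T.X \ T.leftX, ∃ b' ∈ (T.X \ T.leftX) ∪ (T.X ∩ T.leftX),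
      T.map b' = b := by
    intro b hb
    obtain ⟨b', hb', h⟩ := T.exists_map_eq hb.1
    refine ⟨b', ?_, h⟩
    by_cases hX : b' ∈ T.leftX
    · exact Or.inr ⟨hb', hX⟩
    · exact Or.inl ⟨hb', hX⟩
  rcases iterate_mem_or_exists_iterate_eq (hV.subset T.diff_subset_V) hpre hz with
    h | ⟨g, hg, j, rfl⟩
  -- The whole orbit of `z` lies in `X \ X̃ ⊆ 𝒱`, so no `N` is admissible.
  · exact ⟨0, zero_mem _, 1, one_pos, fun N hN => absurd (T.diff_subset_V (h N)) hN.2⟩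
  · have hX := T.iterate_leftMap_mem hg.2 j
    have h1 := T.eventually_mem_X_left hX
    rw [eventually_iff, mem_nhdsLT_iff_exists_Ico_subset] at h1
    obtain ⟨r, hr, hsub⟩ := h1
    rw [Set.mem_Iio] at hr
    have hb := neg_mem (T.sub_iterate_mem hA j hg)
    rw [neg_sub] at hb
    refine ⟨T.leftMap^[j] g - T.map^[j] g, hb, T.leftMap^[j] g - r,
      sub_pos.2 hr, fun N hN => ⟨?_, ?_, ?_⟩⟩
    · rw [add_sub_cancel, sub_sub_cancel]
      exact hsub
    · rwa [add_sub_cancel]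
    · rw [← Function.iterate_add_apply] at hN ⊢
      rw [add_sub_cancel, ← Function.iterate_add_apply]
      exact (T.iterate_eq_of_notMem_V _ hg (Or.inl rfl) hN.1 hN.2).symm

/-! ### Transfer of backward orbits -/

lemma eventually_div_pow_le (T : RightContBetaTransformation β) (c : ℝ) {ε : ℝ} (hε : 0 < ε) :
    ∀ᶠ N : ℕ in atTop, c / β ^ N ≤ ε := by
  have h : Tendsto (fun N : ℕ => c / β ^ N) atTop (𝓝 0) :=
    tendsto_const_nhds.div_atTop (tendsto_pow_atTop_atTop_of_one_lt T.one_lt)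
  exact (h.eventually (gt_mem_nhds hε)).mono fun _ h => h.le

/-- If `𝒱` does not separate `x < x'`, then every long branch of backward orbits of `x` can be
transferred to a branch of backward orbits of `x'`, with a bounded change of the first element. -/
lemma exists_transfer_right (hA : ∀ a ∈ T.digits, a ∈ Algebra.adjoin ℤ {β}) {x x' : ℝ}
    (hlt : x < x') (hx' : x' ∈ T.X) (hI : ∀ t ∈ Set.Ioc x x', t ∉ T.V) :
    ∃ B : Set ℝ, B.Finite ∧ (∀ b ∈ B, b ∈ Algebra.adjoin ℤ {β}) ∧
      ∀ᶠ N in atTop, ∀ y ∈ T.X, T.map^[N] y = x → ∃ y' ∈ T.X, T.map^[N] y' = x' ∧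
        ∃ b ∈ B, (β ^ N * y' - x') - (β ^ N * y - x) = β ^ N * b := by
  have hIX : ∀ t ∈ Set.Ioc x x', t ∈ T.X \ T.V := fun t ht =>
    ⟨T.Icc_subset_X hx' hI ⟨ht.1.le, ht.2⟩, hI t ht⟩
  have hjump : ∀ z, ∃ b ∈ Algebra.adjoin ℤ {β}, ∃ ε > 0, z ∈ T.leftX \ T.X →
      ∀ N, T.leftMap^[N] z ∈ T.X \ T.V →
      Set.Icc (z + b) (z + b + ε) ⊆ T.X ∧ T.map^[N] (z + b) = T.leftMap^[N] z := by
    intro z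
    by_cases hz : z ∈ T.leftX \ T.X
    · obtain ⟨b, hb, ε, hε, h⟩ := T.exists_jump_right hA hz
      exact ⟨b, hb, ε, hε, fun _ => h⟩
    · exact ⟨0, zero_mem _, 1, one_pos, fun h => absurd h hz⟩
  choose b hb ε hε hjump using hjump
  refine ⟨insert 0 (b '' (T.leftX \ T.X)), (T.finite_leftX_diff_X.image b).insert 0, ?_, ?_⟩
  · rintro _ (rfl | ⟨z, -, rfl⟩)
    · exact zero_mem _
    · exact hb z
  -- For large `N` the whole shift fits into the room `ε z` available after a jump, so one jump
  -- suffices.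
  have hN : ∀ᶠ N : ℕ in atTop, ∀ z ∈ T.leftX \ T.X, (x' - x) / β ^ N ≤ ε z :=
    (eventually_all_finite T.finite_leftX_diff_X).2 fun z _ => T.eventually_div_pow_le _ (hε z)
  filter_upwards [hN] with N hN y hy hyx
  have hβN : 0 < β ^ N := pow_pos T.beta_pos N
  -- This is the point sent to `x'` by the affine branch of `T^N` through `y`.
  set y' := y + (x' - x) / β ^ N with hy'
  have hyy' : β ^ N * y' = β ^ N * y + (x' - x) := by rw [hy']; field_simp
  have hrange : ∀ s ∈ Set.Ioc y y', β ^ N * s + (x - β ^ N * y) ∈ Set.Ioc x x' := fun s hs => by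
    have h1 := mul_lt_mul_of_pos_left hs.1 hβN
    have h2 := mul_le_mul_of_nonneg_left hs.2 hβN.le
    constructor <;> linarith
  have hle : y ≤ y' := by
    have : 0 ≤ (x' - x) / β ^ N := div_nonneg (by linarith) hβN.le
    linarith
  by_cases hX : Set.Icc y y' ⊆ T.X
  · refine ⟨y', hX ⟨hle, le_rfl⟩, ?_, 0, Or.inl rfl, by linarith⟩
    rw [T.iterate_eq_affine (c := x - β ^ N * y) hX (fun s hs => hIX _ (hrange s hs))
      ⟨le_rfl, hle⟩ (by linarith) ⟨hle, le_rfl⟩]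
    linarith
  · obtain ⟨z, hz, hzd, hzX⟩ := T.exists_exit hy hX
    -- The affine formula holds up to just before the exit `z`; its limit from the left is `T̃^N z`.
    have hleft : T.leftMap^[N] z = β ^ N * z + (x - β ^ N * y) := by
      obtain ⟨r, h1, h2⟩ := ((T.eventually_iterate_left N hzd.1).and (Ioo_mem_nhdsLT hz.1)).exists
      have hsub : Set.Icc y r ⊆ T.X := fun s hs => hzX ⟨hs.1, hs.2.trans_lt h2.2⟩
      rw [T.iterate_eq_affine (c := x - β ^ N * y) hsub
        (fun s hs => hIX _ (hrange s ⟨hs.1, (hs.2.trans h2.2.le).trans hz.2⟩))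
        ⟨le_rfl, h2.1.le⟩ (by linarith) ⟨h2.1.le, le_rfl⟩] at h1
      linarith
    set t := T.leftMap^[N] z with ht
    have htI : t ∈ Set.Ioc x x' := by
      rw [hleft]
      exact hrange z hz
    obtain ⟨h1, h2⟩ := hjump z hzd N (hIX t htI)
    rw [← ht] at h2
    set w := z + b z with hw
    -- After the jump to `w`, which `T^N` sends to `t`, only the distance `x' - t` remains to be
    -- covered.
    set w' := w + (x' - t) / β ^ N with hw'
    have hww' : β ^ N * w' = β ^ N * w + (x' - t) := by rw [hw']; field_simp
    have hle' : w ≤ w' := by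
      have : 0 ≤ (x' - t) / β ^ N := div_nonneg (by linarith [htI.2]) hβN.le
      linarith
    have hlew : w' ≤ w + ε z := by
      have := hN z hzd
      have h3 : (x' - t) / β ^ N ≤ (x' - x) / β ^ N := by gcongr; exact htI.1.le
      linarith
    have hsub : Set.Icc w w' ⊆ T.X := fun s hs => h1 ⟨hs.1, hs.2.trans hlew⟩
    refine ⟨w', hsub ⟨hle', le_rfl⟩, ?_, b z, Or.inr ⟨z, hzd, rfl⟩, ?_⟩
    · rw [T.iterate_eq_affine (c := t - β ^ N * w) hsub (fun s hs => hIX _ ?_)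
        ⟨le_rfl, hle'⟩ (by linarith) ⟨hle', le_rfl⟩]
      · linarith
      · have h1 := mul_lt_mul_of_pos_left hs.1 hβN
        have h2 := mul_le_mul_of_nonneg_left hs.2 hβN.le
        constructor <;> linarith [htI.1]
    · have : β ^ N * w = β ^ N * z + β ^ N * b z := by rw [hw]; ring
      linarith

/-- If `𝒱` does not separate `x < x'`, then every long branch of backward orbits of `x'` can be
transferred to a branch of backward orbits of `x`, with a bounded change of the first element. -/
lemma exists_transfer_left (hA : ∀ a ∈ T.digits, a ∈ Algebra.adjoin ℤ {β}) (hV : T.V.Finite)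
    {x x' : ℝ} (hlt : x < x') (hx' : x' ∈ T.X) (hI : ∀ t ∈ Set.Ioc x x', t ∉ T.V) :
    ∃ B : Set ℝ, B.Finite ∧ (∀ b ∈ B, b ∈ Algebra.adjoin ℤ {β}) ∧
      ∀ᶠ N in atTop, ∀ y' ∈ T.X, T.map^[N] y' = x' → ∃ y ∈ T.X, T.map^[N] y = x ∧
        ∃ b ∈ B, (β ^ N * y - x) - (β ^ N * y' - x') = β ^ N * b := by
  have hIX : ∀ t ∈ Set.Ioc x x', t ∈ T.X \ T.V := fun t ht =>
    ⟨T.Icc_subset_X hx' hI ⟨ht.1.le, ht.2⟩, hI t ht⟩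
  have hfin : (T.X \ T.leftX).Finite := hV.subset T.diff_subset_V
  have hjump : ∀ z, ∃ b ∈ Algebra.adjoin ℤ {β}, ∃ ε > 0, z ∈ T.X \ T.leftX →
      ∀ N, T.map^[N] z ∈ T.X \ T.V →
      Set.Ico (z + b - ε) (z + b) ⊆ T.X ∧ z + b ∈ T.leftX ∧
        T.leftMap^[N] (z + b) = T.map^[N] z := by
    intro z
    by_cases hz : z ∈ T.X \ T.leftX
    · obtain ⟨b, hb, ε, hε, h⟩ := T.exists_jump_left hA hV hz
      exact ⟨b, hb, ε, hε, fun _ => h⟩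
    · exact ⟨0, zero_mem _, 1, one_pos, fun h => absurd h hz⟩
  choose b hb ε hε hjump using hjump
  refine ⟨insert 0 (b '' (T.X \ T.leftX)), (hfin.image b).insert 0, ?_, ?_⟩
  · rintro _ (rfl | ⟨z, -, rfl⟩)
    · exact zero_mem _
    · exact hb z
  have hN : ∀ᶠ N : ℕ in atTop, ∀ z ∈ T.X \ T.leftX, (x' - x) / β ^ N ≤ ε z :=
    (eventually_all_finite hfin).2 fun z _ => T.eventually_div_pow_le _ (hε z)
  filter_upwards [hN] with N hN y' hy' hyx
  have hβN : 0 < β ^ N := pow_pos T.beta_pos N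
  set y := y' - (x' - x) / β ^ N with hy
  have hyy' : β ^ N * y = β ^ N * y' - (x' - x) := by rw [hy]; field_simp
  have hrange : ∀ s ∈ Set.Ioc y y', β ^ N * s + (x' - β ^ N * y') ∈ Set.Ioc x x' := fun s hs => by
    have h1 := mul_lt_mul_of_pos_left hs.1 hβN
    have h2 := mul_le_mul_of_nonneg_left hs.2 hβN.le
    constructor <;> linarith
  have hle : y ≤ y' := by
    have : 0 ≤ (x' - x) / β ^ N := div_nonneg (by linarith) hβN.le
    linarith
  by_cases hX : Set.Icc y y' ⊆ T.X
  · refine ⟨y, hX ⟨le_rfl, hle⟩, ?_, 0, Or.inl rfl, by linarith⟩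
    rw [T.iterate_eq_affine (c := x' - β ^ N * y') hX (fun s hs => hIX _ (hrange s hs))
      ⟨hle, le_rfl⟩ (by linarith) ⟨le_rfl, hle⟩]
    linarith
  · obtain ⟨z, hz, hzd, hzX⟩ := T.exists_entry hy' hX
    have hright : T.map^[N] z = β ^ N * z + (x' - β ^ N * y') :=
      T.iterate_eq_affine (c := x' - β ^ N * y') hzX
        (fun s hs => hIX _ (hrange s ⟨hz.1.trans hs.1, hs.2⟩))
        ⟨hz.2, le_rfl⟩ (by linarith) ⟨le_rfl, hz.2⟩
    set t := T.map^[N] z with ht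
    have htI : t ∈ Set.Ioc x x' := by
      rw [hright]
      exact hrange z hz
    obtain ⟨h1, h2, h3⟩ := hjump z hzd N (hIX t htI)
    rw [← ht] at h3
    set w := z + b z with hw
    set w' := w - (t - x) / β ^ N with hw'
    have hww' : β ^ N * w' = β ^ N * w - (t - x) := by rw [hw']; field_simp
    have hlt' : w' < w := by
      have : 0 < (t - x) / β ^ N := div_pos (by linarith [htI.1]) hβN
      linarith
    have hlew : w - ε z ≤ w' := by
      have := hN z hzd
      have h3 : (t - x) / β ^ N ≤ (x' - x) / β ^ N := by gcongr; exact htI.2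
      linarith
    -- The landing point `w` need not belong to `X`, so the leftward branch is started at a point
    -- `r` just below it.
    obtain ⟨r, h4, h5⟩ := ((T.eventually_iterate_left N h2).and (Ioo_mem_nhdsLT hlt')).exists
    rw [h3] at h4
    have hsub : Set.Icc w' r ⊆ T.X := fun s hs => h1 ⟨hlew.trans hs.1, hs.2.trans_lt h5.2⟩
    refine ⟨w', hsub ⟨le_rfl, h5.1.le⟩, ?_, b z, Or.inr ⟨z, hzd, rfl⟩, ?_⟩
    · rw [T.iterate_eq_affine (c := t - β ^ N * w) hsub (fun s hs => hIX _ ?_)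
        ⟨h5.1.le, le_rfl⟩ (by linarith) ⟨le_rfl, h5.1.le⟩]
      · linarith
      · have h1 := mul_lt_mul_of_pos_left hs.1 hβN
        have h2 := mul_lt_mul_of_pos_left (hs.2.trans_lt h5.2) hβN
        constructor <;> linarith [htI.2]
    · have : β ^ N * w = β ^ N * z + β ^ N * b z := by rw [hw]; ring
      linarith

end RightContBetaTransformation

/-! ### The map `Φ` on `ℤ[β]` viewed inside `ℝ` -/

section PhiReal

variable (β : ℝ) [IsPisotUnit β]

open Classical in
/-- The map `Φ` as a function of real numbers, extended by zero off `ℚ(β)`. -/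
noncomputable def pisotPhiReal (a : ℝ) : pisotH β :=
  if h : a ∈ ℚ⟮β⟯ then pisotPhi β ⟨a, h⟩ else 0

lemma pisotPhiReal_coe (x : ℚ⟮β⟯) : pisotPhiReal β x = pisotPhi β x := by
  rw [pisotPhiReal, dif_pos x.2]

omit [IsPisotUnit β] in
lemma exists_coe_eq {a : ℝ} (ha : a ∈ Algebra.adjoin ℤ {β}) : ∃ x : ℚ⟮β⟯, (x : ℝ) = a := by
  have hle : Algebra.adjoin ℤ {β} ≤ (ℚ⟮β⟯.toSubalgebra.restrictScalars ℤ) :=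
    Algebra.adjoin_le (by
      rintro _ rfl
      exact IntermediateField.mem_adjoin_simple_self ℚ _)
  exact ⟨⟨a, hle ha⟩, rfl⟩

lemma pisotPhiReal_add {a b : ℝ} (ha : a ∈ Algebra.adjoin ℤ {β}) (hb : b ∈ Algebra.adjoin ℤ {β}) :
    pisotPhiReal β (a + b) = pisotPhiReal β a + pisotPhiReal β b := by
  obtain ⟨x, rfl⟩ := exists_coe_eq β ha
  obtain ⟨y, rfl⟩ := exists_coe_eq β hb
  rw [pisotPhiReal_coe, pisotPhiReal_coe, ← pisotPhi_add, ← pisotPhiReal_coe]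
  rfl

lemma pisotPhiReal_pow_mul (n : ℕ) {a : ℝ} (ha : a ∈ Algebra.adjoin ℤ {β}) :
    pisotPhiReal β (β ^ n * a) = (pisotM β ^ n) (pisotPhiReal β a) := by
  obtain ⟨x, rfl⟩ := exists_coe_eq β ha
  rw [pisotPhiReal_coe, ← pisotPhi_genBeta_pow_mul, ← pisotPhiReal_coe]
  rfl

lemma pisotPhiReal_mul {a : ℝ} (ha : a ∈ Algebra.adjoin ℤ {β}) :
    pisotPhiReal β (β * a) = pisotM β (pisotPhiReal β a) := by
  have := pisotPhiReal_pow_mul β 1 ha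
  rwa [pow_one, pow_one] at this

end PhiReal

namespace RightContBetaTransformation

variable {β : ℝ} (T : RightContBetaTransformation β)

/-! ### Expansions -/

lemma expansion_map (x : ℝ) (n : ℕ) : T.expansion (T.map x) n = T.expansion x (n + 1) := rfl

lemma exists_abs_le_of_mem_X : ∃ K, ∀ x ∈ T.X, |x| ≤ K := by
  have h : Bornology.IsBounded T.X := by
    rw [X]
    refine (Bornology.isBounded_biUnion_finset _).2 fun a _ => ?_
    exact (Bornology.isBounded_biUnion_finset _).2 fun p _ => Metric.isBounded_Ico _ _
  obtain ⟨K, hK⟩ := h.exists_norm_le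
  exact ⟨K, hK⟩

lemma sub_eq_of_expansion_eq {x x' : ℝ} (h : T.expansion x = T.expansion x') (n : ℕ) :
    T.map^[n] x - T.map^[n] x' = β ^ n * (x - x') := by
  induction n with
  | zero => simp
  | succ n ih =>
    have hn : T.digit (T.map^[n] x) = T.digit (T.map^[n] x') := congrFun h n
    rw [Function.iterate_succ_apply', Function.iterate_succ_apply', map, map, hn,
      sub_sub_sub_cancel_right, ← mul_sub, ih]
    ring

/-- Points with equal expansions separate by the factor `β` at each step, while `X` is bounded. -/
lemma expansion_injOn : Set.InjOn T.expansion T.X := by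
  intro x hx x' hx' h
  obtain ⟨K, hK⟩ := T.exists_abs_le_of_mem_X
  by_contra hne
  have hpos : 0 < |x - x'| := abs_pos.2 (sub_ne_zero.2 hne)
  obtain ⟨n, hn⟩ := pow_unbounded_of_one_lt (2 * K / |x - x'|) T.one_lt
  have h1 := T.sub_eq_of_expansion_eq h n
  have h2 : |T.map^[n] x - T.map^[n] x'| ≤ 2 * K := by
    have h3 := hK _ (T.iterate_map_mem hx n)
    have h4 := hK _ (T.iterate_map_mem hx' n)
    have := abs_sub (T.map^[n] x) (T.map^[n] x')
    linarith
  rw [h1, abs_mul, abs_of_pos (pow_pos T.beta_pos n)] at h2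
  rw [div_lt_iff₀ hpos] at hn
  linarith

/-! ### Branches of backward orbits -/

/-- `y` is a backward orbit of `x` in the set `S`. -/
def IsBackwardOrbit (S : Set ℝ) (x : ℝ) (y : ℕ → ℝ) : Prop :=
  y 0 = x ∧ ∀ n, y n ∈ S ∧ T.map (y (n + 1)) = y n

/-- The part of the tile of `x` that comes from backward orbits in `S`. -/
def branchTile [IsPisotUnit β] (S : Set ℝ) (x : ℝ) : Set (pisotH β) :=
  {p | ∃ y, T.IsBackwardOrbit S x y ∧
    HasSum (fun n => (pisotM β ^ n) (pisotPhiReal β (T.digit (y (n + 1))))) p}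

variable {T}

lemma IsBackwardOrbit.iterate {S : Set ℝ} {x : ℝ} {y : ℕ → ℝ} (h : T.IsBackwardOrbit S x y)
    (n k : ℕ) : T.map^[n] (y (k + n)) = y k := by
  induction n with
  | zero => rfl
  | succ n ih => rw [Function.iterate_succ_apply, ← add_assoc, (h.2 _).2, ih]

lemma concat_of_le {w : ℕ → ℚ⟮β⟯} {v : ℕ → ℝ} {k : ℤ} (n : ℕ) (hk : k = -n) :
    concat w v k = w n := by
  subst hk
  simp [concat]

lemma concat_of_pos {w : ℕ → ℚ⟮β⟯} {v : ℕ → ℝ} {k : ℤ} (n : ℕ) (hk : k = n + 1) :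
    concat w v k = v n := by
  subst hk
  have : ¬ ((n : ℤ) + 1 ≤ 0) := by omega
  simp [concat, this]

variable [IsPisotUnit β]

/-- By injectivity of expansions, each right tail of an element of `𝒮` determines a point of `X`,
and `T` maps each of these points to the next. Left-infinite words admissible before `b(x)` are thus
the digit sequences of backward orbits of `x`. -/
lemma tile_eq_branchTile (hA : ∀ a ∈ T.digits, a ∈ Algebra.adjoin ℤ {β}) {x : ℝ} (hx : x ∈ T.X) :
    T.tile x = T.branchTile T.X x := by
  ext p
  constructor
  · rintro ⟨w, ⟨-, hw⟩, hp⟩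
    choose z hz hzw using hw
    have hz1 : z 1 = x := by
      refine T.expansion_injOn (hz 1) hx ?_
      rw [← hzw]
      funext n
      exact concat_of_pos n (by ring)
    have hzs : ∀ k, T.map (z k) = z (k + 1) := fun k => by
      refine T.expansion_injOn (T.map_mem (hz k)) (hz _) ?_
      rw [← hzw (k + 1)]
      funext n
      rw [expansion_map, ← congrFun (hzw k) (n + 1)]
      congr 1
      push_cast
      ring
    -- The tail starting at position `1` is `b(x)`, so `z 1 = x` is the start of the backward orbit,
    -- and the digit of `z (-n)` is `w n`.
    refine ⟨fun n => z (1 - n), ⟨by simpa using hz1, fun n => ⟨hz _, ?_⟩⟩, ?_⟩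
    · rw [hzs]
      congr 1
      push_cast
      ring
    · refine hp.congr_fun fun n => ?_
      have hd : T.digit (z (1 - ((n + 1 : ℕ) : ℤ))) = w n := by
        have := congrFun (hzw (-n)) 0
        rw [concat_of_le n (by simp)] at this
        rw [this, expansion]
        congr 2
        push_cast
        ring
      rw [mul_comm, pisotPhi_genBeta_pow_mul, ← pisotPhiReal_coe, ← hd]
  · rintro ⟨y, hy, hp⟩
    have hyX := fun n => T.digit_mem (hy.2 n).1
    choose w hw using fun n => exists_coe_eq β (hA _ (hyX (n + 1)).1)
    refine ⟨w, ⟨fun k => ?_, fun k => ?_⟩, ?_⟩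
    · rcases le_or_gt k 0 with hk | hk
      · rw [concat_of_le (-k).toNat (by omega), hw]
        exact (hyX _).1
      · rw [concat_of_pos (k - 1).toNat (by omega)]
        exact (T.digit_mem (T.iterate_map_mem hx _)).1
    · rcases le_or_gt k 0 with hk | hk
      · obtain ⟨m, rfl⟩ : ∃ m : ℕ, k = -m := ⟨(-k).toNat, by omega⟩
        refine ⟨y (m + 1), (hy.2 _).1, funext fun n => ?_⟩
        rcases le_or_gt n m with hn | hn
        · rw [concat_of_le (m - n) (by omega), hw, expansion]
          have := hy.iterate n (m - n + 1)
          rw [show m - n + 1 + n = m + 1 by omega] at this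
          rw [this]
        · rw [concat_of_pos (n - (m + 1)) (by omega), expansion, expansion]
          have := hy.iterate (m + 1) 0
          rw [zero_add, hy.1] at this
          rw [← this, ← Function.iterate_add_apply, Nat.sub_add_cancel hn]
      · refine ⟨T.map^[(k - 1).toNat] x, T.iterate_map_mem hx _, funext fun n => ?_⟩
        rw [concat_of_pos (n + (k - 1).toNat) (by omega), expansion, expansion,
          Function.iterate_add_apply]
    · refine hp.congr_fun fun n => ?_
      rw [mul_comm, pisotPhi_genBeta_pow_mul, ← pisotPhiReal_coe, ← hw]

variable (T) in
lemma exists_digit_bound : ∃ K ρ : ℝ, 0 < K ∧ 0 < ρ ∧ ρ < 1 ∧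
    ∀ n, ∀ a ∈ T.digits, ‖(pisotM β ^ n) (pisotPhiReal β a)‖ ≤ K * ρ ^ n := by
  obtain ⟨C, ρ, hC, hρ0, hρ1, hM⟩ := exists_norm_pisotM_pow_le β
  obtain ⟨D, hD⟩ := (T.digits.finite_toSet.image fun a => ‖pisotPhiReal β a‖).bddAbove
  refine ⟨C * max D 1, ρ, by positivity, hρ0, hρ1, fun n a ha => (hM n _).trans ?_⟩
  have : ‖pisotPhiReal β a‖ ≤ max D 1 := le_max_of_le_left (hD ⟨a, ha, rfl⟩)
  calc C * ρ ^ n * ‖pisotPhiReal β a‖ ≤ C * ρ ^ n * max D 1 := by gcongr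
    _ = _ := by ring

lemma summable_branch {d : ℕ → ℝ} (hd : ∀ n, d n ∈ T.digits) :
    Summable (fun n => (pisotM β ^ n) (pisotPhiReal β (d n))) := by
  obtain ⟨K, ρ, -, hρ0, hρ1, h⟩ := T.exists_digit_bound
  exact Summable.of_norm_bounded ((summable_geometric_of_lt_one hρ0.le hρ1).mul_left K)
    fun n => h n _ (hd n)

variable (T) in
/-- The branch tiles are uniformly bounded. -/
lemma exists_norm_le_of_mem_branchTile :
    ∃ R, 0 < R ∧ ∀ S ⊆ T.X, ∀ x, ∀ p ∈ T.branchTile S x, ‖p‖ ≤ R := by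
  obtain ⟨K, ρ, hK, hρ0, hρ1, h⟩ := T.exists_digit_bound
  refine ⟨K * (1 - ρ)⁻¹, mul_pos hK (inv_pos.2 (by linarith)), ?_⟩
  rintro S hS x p ⟨y, hy, hp⟩
  rw [← hp.tsum_eq]
  exact tsum_of_norm_bounded ((hasSum_geometric_of_lt_one hρ0.le hρ1).mul_left K)
    fun n => h n _ (T.digit_mem (hS (hy.2 _).1)).1

lemma branchTile_mono {S S' : Set ℝ} (h : S ⊆ S') (x : ℝ) :
    T.branchTile S x ⊆ T.branchTile S' x := by
  rintro p ⟨y, hy, hp⟩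
  exact ⟨y, ⟨hy.1, fun n => ⟨h (hy.2 n).1, (hy.2 n).2⟩⟩, hp⟩

lemma branchTile_nonempty {S : Set ℝ} (hS : S ⊆ T.X) (hsurj : ∀ x ∈ S, ∃ y ∈ S, T.map y = x)
    {x : ℝ} (hx : x ∈ S) : (T.branchTile S x).Nonempty := by
  choose! f hfS hf using hsurj
  have hmem : ∀ n, f^[n] x ∈ S := fun n => (Set.MapsTo.iterate (fun a ha => hfS a ha) n :
    Set.MapsTo _ S S) hx
  refine ⟨_, fun n => f^[n] x, ⟨rfl, fun n => ⟨hmem n, ?_⟩⟩,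
    (summable_branch fun n => (T.digit_mem (hS (hmem (n + 1)))).1).hasSum⟩
  change T.map (f^[n + 1] x) = f^[n] x
  rw [Function.iterate_succ_apply', hf _ (hmem n)]

/-- Together with `mem_branchTile_map` this is the set equation of the tiles, obtained by splitting
off the first digit. -/
lemma exists_of_mem_branchTile {S : Set ℝ} (hS : S ⊆ T.X) {x : ℝ} {p : pisotH β}
    (hp : p ∈ T.branchTile S x) : ∃ y ∈ S, T.map y = x ∧
      ∃ q ∈ T.branchTile S y, p = pisotPhiReal β (T.digit y) + pisotM β q := by
  obtain ⟨y, hy, hp⟩ := hp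
  have hs : Summable fun n => (pisotM β ^ n) (pisotPhiReal β (T.digit (y (n + 2)))) :=
    summable_branch fun n => (T.digit_mem (hS (hy.2 _).1)).1
  refine ⟨y 1, (hy.2 1).1, (hy.2 0).2.trans hy.1, _,
    ⟨fun n => y (n + 1), ⟨rfl, fun n => hy.2 (n + 1)⟩, hs.hasSum⟩, ?_⟩
  have h1 := (pisotM β).hasSum hs.hasSum
  have h2 := (hasSum_nat_add_iff' 1).2 hp
  have h3 := h2.unique (h1.congr_fun fun n => by rw [pow_succ', mul_apply_eq_comp])
  rw [← h3]
  simp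

lemma mem_branchTile_map {S : Set ℝ} (hSm : Set.MapsTo T.map S S) {y : ℝ}
    (hy : y ∈ S) {q : pisotH β} (hq : q ∈ T.branchTile S y) :
    pisotPhiReal β (T.digit y) + pisotM β q ∈ T.branchTile S (T.map y) := by
  obtain ⟨z, hz, hq⟩ := hq
  refine ⟨fun n => Nat.casesOn n (T.map y) z, ⟨rfl, fun n => ?_⟩, ?_⟩
  · cases n with
    | zero => exact ⟨hSm hy, congrArg T.map hz.1⟩
    | succ n => exact hz.2 n
  · rw [← hasSum_nat_add_iff' 1]
    have h1 := (pisotM β).hasSum hq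
    have h2 : ∀ p : pisotH β, p + pisotM β q - p = pisotM β q := fun p => add_sub_cancel_left _ _
    rw [Finset.sum_range_one]
    simp only [pow_zero, one_apply_eq_self, hz.1, h2]
    exact h1.congr_fun fun n => by rw [pow_succ', mul_apply_eq_comp]

/-- In the iterated set equation the first `n` digits contribute `β^n y - T^n y`, so the translation
depends on `y` and `n` alone. -/
lemma exists_iterate_of_mem_branchTile (hA : ∀ a ∈ T.digits, a ∈ Algebra.adjoin ℤ {β})
    {S : Set ℝ} (hS : S ⊆ T.X) (n : ℕ) {x : ℝ} {p : pisotH β} (hp : p ∈ T.branchTile S x) :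
    ∃ y ∈ S, T.map^[n] y = x ∧
      ∃ q ∈ T.branchTile S y, p = pisotPhiReal β (β ^ n * y - x) + (pisotM β ^ n) q := by
  induction n generalizing x p with
  | zero =>
    have h0 : pisotPhiReal β (β ^ 0 * x - x) = 0 := by
      rw [pow_zero, one_mul, sub_self]
      exact (pisotPhiReal_coe β 0).trans (pisotPhi_zero β)
    refine ⟨x, ?_, rfl, p, hp, ?_⟩
    · obtain ⟨y, hy, -⟩ := hp
      exact hy.1 ▸ (hy.2 0).1
    · rw [h0]
      simp
  | succ n ih =>
    obtain ⟨y, hy, rfl, q, hq, rfl⟩ := exists_of_mem_branchTile hS hp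
    obtain ⟨z, hz, rfl, r, hr, rfl⟩ := ih hq
    refine ⟨z, hz, Function.iterate_succ_apply' _ _ _, r, hr, ?_⟩
    have hd := hA _ (T.digit_mem (hS hy)).1
    have h1 := T.sub_iterate_map_mem hA n (hS hz)
    have hβ : β ∈ Algebra.adjoin ℤ {β} := Algebra.subset_adjoin rfl
    rw [map_add, ← add_assoc, ← pisotPhiReal_mul β h1,
      ← pisotPhiReal_add β hd (mul_mem hβ h1), pow_succ' (pisotM β), mul_apply_eq_comp]
    congr 2
    rw [map]
    ring

lemma mem_branchTile_iterate (hA : ∀ a ∈ T.digits, a ∈ Algebra.adjoin ℤ {β})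
    {S : Set ℝ} (hS : S ⊆ T.X) (hSm : Set.MapsTo T.map S S) (n : ℕ) {y : ℝ}
    (hy : y ∈ S) {q : pisotH β} (hq : q ∈ T.branchTile S y) :
    pisotPhiReal β (β ^ n * y - T.map^[n] y) + (pisotM β ^ n) q ∈
      T.branchTile S (T.map^[n] y) := by
  induction n with
  | zero =>
    have h0 : pisotPhiReal β (β ^ 0 * y - y) = 0 := by
      rw [pow_zero, one_mul, sub_self]
      exact (pisotPhiReal_coe β 0).trans (pisotPhi_zero β)
    rw [Function.iterate_zero_apply, h0]
    simpa using hq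
  | succ n ih =>
    have hyn : T.map^[n] y ∈ S := (hSm.iterate n) hy
    have h := mem_branchTile_map hSm hyn ih
    rw [Function.iterate_succ_apply']
    convert h using 1
    have hd := hA _ (T.digit_mem (hS hyn)).1
    have h1 := T.sub_iterate_map_mem hA n (hS hy)
    have hβ : β ∈ Algebra.adjoin ℤ {β} := Algebra.subset_adjoin rfl
    rw [map_add, ← add_assoc, ← pisotPhiReal_mul β h1,
      ← pisotPhiReal_add β hd (mul_mem hβ h1), pow_succ' (pisotM β), mul_apply_eq_comp]
    congr 2
    rw [map]
    ring

/-! ### Compactness -/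

variable (T) in
/-- The points of the backward orbit of `x` determined by a sequence of digits. -/
noncomputable def backPoint (x : ℝ) (w : ℕ → T.digits) : ℕ → ℝ
  | 0 => x
  | n + 1 => (backPoint x w n + w n) / β

omit [IsPisotUnit β] in
lemma isLocallyConstant_backPoint (x : ℝ) (n : ℕ) :
    IsLocallyConstant fun w : ℕ → T.digits => T.backPoint x w n := by
  induction n with
  | zero => exact IsLocallyConstant.const x
  | succ n ih =>
    have h : IsLocallyConstant fun w : ℕ → T.digits => w n :=
      (IsLocallyConstant.iff_continuous _).2 (continuous_apply n)
    exact ih.comp₂ h fun a d => (a + d) / β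

variable (T) in
-- The tile is a continuous image of a set of digit sequences in the compact space `A^ℕ`. Membership
-- in this set is a family of conditions on finitely many digits each, so the set is closed whatever
-- `S` is.
lemma isCompact_branchTile {S : Set ℝ} (hS : S ⊆ T.X) (x : ℝ) :
    IsCompact (T.branchTile S x) := by
  obtain ⟨C, ρ, hC, hρ0, hρ1, hbd⟩ := T.exists_digit_bound
  have hb := T.beta_pos
  set F : (ℕ → T.digits) → pisotH β := fun w => ∑' n, (pisotM β ^ n) (pisotPhiReal β (w n))
  have hF : Continuous F := by
    refine continuous_tsum (fun n => ?_) ((summable_geometric_of_lt_one hρ0.le hρ1).mul_left C)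
      fun n w => hbd n _ (w n).2
    exact (continuous_of_discreteTopology
      (f := fun d : T.digits => (pisotM β ^ n) (pisotPhiReal β d))).comp (continuous_apply n)
  set K : Set (ℕ → T.digits) :=
    ⋂ n, {w | T.backPoint x w n ∈ S ∧ T.digit (T.backPoint x w (n + 1)) = w n}
  have hK : IsClosed K := by
    refine isClosed_iInter fun n => ?_
    have h1 := isLocallyConstant_backPoint (T := T) x n
    have h2 := isLocallyConstant_backPoint (T := T) x (n + 1)
    have h3 : IsLocallyConstant fun w : ℕ → T.digits => w n :=
      (IsLocallyConstant.iff_continuous _).2 (continuous_apply n)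
    have h4 : IsLocallyConstant fun w : ℕ → T.digits =>
        (T.backPoint x w n ∈ S ∧ T.digit (T.backPoint x w (n + 1)) = w n) :=
      (h1.comp (· ∈ S)).comp₂ (h2.comp₂ h3 fun a d => T.digit a = d) And
    simpa using h4.isClosed_fiber True
  have himage : T.branchTile S x = F '' K := by
    ext p
    constructor
    · rintro ⟨y, hy, hp⟩
      have hd := fun n => T.digit_mem (hS (hy.2 n).1)
      set w : ℕ → T.digits := fun n => ⟨T.digit (y (n + 1)), (hd (n + 1)).1⟩ with hw
      have hback : ∀ n, T.backPoint x w n = y n := by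
        intro n
        induction n with
        | zero => exact hy.1.symm
        | succ n ih =>
          rw [backPoint, ih, ← (hy.2 n).2, map, hw, sub_add_cancel, mul_div_cancel_left₀ _ hb.ne']
      refine ⟨w, Set.mem_iInter.2 fun n => ⟨?_, ?_⟩, hp.tsum_eq⟩
      · rw [hback]
        exact (hy.2 n).1
      · rw [hback]
    · rintro ⟨w, hw, rfl⟩
      rw [Set.mem_iInter] at hw
      refine ⟨T.backPoint x w, ⟨rfl, fun n => ⟨(hw n).1, ?_⟩⟩, ?_⟩
      · rw [map, (hw n).2, backPoint]
        field_simp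
        ring
      · simp only [(hw _).2]
        exact (summable_branch fun n => (w n).2).hasSum
  rw [himage]
  exact (hK.isCompact).image hF

variable (T) in
lemma isClosed_branchTile {S : Set ℝ} (hS : S ⊆ T.X) (x : ℝ) : IsClosed (T.branchTile S x) :=
  (T.isCompact_branchTile hS x).isClosed

/-! ### Dependence on the base point -/

/-- Replacing the branch `y` by `y'` moves a point by `M^N` applied to a bounded vector, since the
jumps come from a finite set and all tiles share one bound. So every point of the first tile is a
limit of points of the second, which is closed. -/
lemma branchTile_subset_of_transfer (hA : ∀ a ∈ T.digits, a ∈ Algebra.adjoin ℤ {β}) {x x' : ℝ}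
    {B : Set ℝ} (hB : B.Finite) (hBm : ∀ b ∈ B, b ∈ Algebra.adjoin ℤ {β})
    (h : ∀ᶠ N in atTop, ∀ y ∈ T.X, T.map^[N] y = x → ∃ y' ∈ T.X, T.map^[N] y' = x' ∧
        ∃ b ∈ B, (β ^ N * y' - x') - (β ^ N * y - x) = β ^ N * b) :
    T.branchTile T.X x ⊆ T.branchTile T.X x' := by
  intro p hp
  obtain ⟨C, ρ, hC, hρ0, hρ1, hM⟩ := exists_norm_pisotM_pow_le β
  obtain ⟨R, hR0, hR⟩ := T.exists_norm_le_of_mem_branchTile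
  obtain ⟨D, hD⟩ := (hB.image fun b => ‖pisotPhiReal β b‖).bddAbove
  rw [← (T.isClosed_branchTile subset_rfl x').closure_eq, Metric.mem_closure_iff]
  intro ε hε
  have hlim : Tendsto (fun N : ℕ => C * ρ ^ N * (D + 2 * R)) atTop (𝓝 0) := by
    have := ((tendsto_pow_atTop_nhds_zero_of_lt_one hρ0.le hρ1).const_mul C).mul_const (D + 2 * R)
    simpa using this
  obtain ⟨N, hN, hNε⟩ := (h.and (hlim.eventually (gt_mem_nhds hε))).exists
  obtain ⟨y, hy, rfl, q, hq, rfl⟩ := exists_iterate_of_mem_branchTile hA subset_rfl N hp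
  obtain ⟨y', hy', rfl, b, hb, hbe⟩ := hN y hy rfl
  obtain ⟨q', hq'⟩ := branchTile_nonempty subset_rfl (fun x hx => T.exists_map_eq hx) hy'
  have hmem := mem_branchTile_iterate (S := T.X) hA subset_rfl (fun _ => T.map_mem) N hy' hq'
  suffices key : dist (pisotPhiReal β (β ^ N * y - T.map^[N] y) + (pisotM β ^ N) q)
      (pisotPhiReal β (β ^ N * y' - T.map^[N] y') + (pisotM β ^ N) q') < ε from
    ⟨_, hmem, key⟩
  have hβ : β ∈ Algebra.adjoin ℤ {β} := Algebra.subset_adjoin rfl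
  have e : pisotPhiReal β (β ^ N * y' - T.map^[N] y') =
      (pisotM β ^ N) (pisotPhiReal β b) + pisotPhiReal β (β ^ N * y - T.map^[N] y) := by
    rw [← pisotPhiReal_pow_mul β N (hBm b hb),
      ← pisotPhiReal_add β (mul_mem (pow_mem hβ N) (hBm b hb)) (T.sub_iterate_map_mem hA N hy), ← hbe,
      sub_add_cancel]
  have e2 : ∀ u v w : pisotH β, v + u + w - (u + (pisotM β ^ N) q) = v + (w - (pisotM β ^ N) q) :=
    fun u v w => by abel
  rw [e, dist_comm, dist_eq_norm, e2, ← map_sub, ← map_add]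
  calc ‖(pisotM β ^ N) (pisotPhiReal β b + (q' - q))‖
      ≤ C * ρ ^ N * ‖pisotPhiReal β b + (q' - q)‖ := hM _ _
    _ ≤ C * ρ ^ N * (D + 2 * R) := by
        have h1 : ‖pisotPhiReal β b‖ ≤ D := hD ⟨b, hb, rfl⟩
        have h2 := hR _ subset_rfl _ _ hq
        have h3 := hR _ subset_rfl _ _ hq'
        have h4 := norm_add_le (pisotPhiReal β b) (q' - q)
        have h5 := norm_sub_le q' q
        gcongr
        linarith
    _ < ε := hNε

/-- The tiles are constant on intervals that do not contain a point of `𝒱`. -/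
lemma branchTile_eq_of_Ioc (hA : ∀ a ∈ T.digits, a ∈ Algebra.adjoin ℤ {β}) (hV : T.V.Finite)
    {x x' : ℝ} (hle : x ≤ x') (hx' : x' ∈ T.X) (hI : ∀ t ∈ Set.Ioc x x', t ∉ T.V) :
    T.branchTile T.X x = T.branchTile T.X x' := by
  rcases hle.eq_or_lt with rfl | hlt
  · rfl
  obtain ⟨B, hB, hBm, h⟩ := T.exists_transfer_right hA hlt hx' hI
  obtain ⟨B', hB', hBm', h'⟩ := T.exists_transfer_left hA hV hlt hx' hI
  exact (branchTile_subset_of_transfer hA hB hBm h).antisymm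
    (branchTile_subset_of_transfer hA hB' hBm' h')

end RightContBetaTransformation

/-! ### Tight coverings and Lebesgue measure on `H` -/

open scoped ENNReal
open MeasureTheory

/-- If a set of measure at least `∑ μ (E i)` is covered by the sets `E i`, then each of these sets
is almost everywhere contained in it. -/
lemma measure_diff_eq_zero_of_sum_le {α ι : Type*} [MeasurableSpace α] {μ : Measure α}
    {s : Finset ι} {E : ι → Set α} {A : Set α} (hA : MeasurableSet A)
    (hsub : A ⊆ ⋃ i ∈ s, E i) (hfin : μ A ≠ ∞) (h : ∑ i ∈ s, μ (E i) ≤ μ A) {i : ι}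
    (hi : i ∈ s) : μ (E i \ A) = 0 := by
  have h1 : μ A ≤ ∑ i ∈ s, μ (E i ∩ A) := by
    refine le_trans (measure_mono fun x hx => ?_) (measure_biUnion_finset_le s _)
    obtain ⟨i, hi, hxi⟩ := Set.mem_iUnion₂.1 (hsub hx)
    exact Set.mem_iUnion₂.2 ⟨i, hi, hxi, hx⟩
  have h2 : ∑ i ∈ s, μ (E i) = ∑ i ∈ s, μ (E i ∩ A) + ∑ i ∈ s, μ (E i \ A) := by
    rw [← Finset.sum_add_distrib]
    exact Finset.sum_congr rfl fun i _ => (measure_inter_add_sdiff _ hA).symm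
  have h3 : μ A + ∑ i ∈ s, μ (E i \ A) ≤ μ A + 0 := by
    rw [add_zero]
    refine le_trans ?_ h
    rw [h2]
    gcongr
  have h4 := (ENNReal.add_le_add_iff_left hfin).1 h3
  exact Finset.sum_eq_zero_iff.1 (le_zero_iff.1 h4) i hi

section Measure

variable (β : ℝ) [IsPisotUnit β]

instance : (lebesgueH β).IsAddHaarMeasure :=
  inferInstanceAs (stdOrthonormalBasis ℝ (pisotH β)).toBasis.addHaar.IsAddHaarMeasure

lemma measure_image_affine (n : ℕ) (c : pisotH β) (s : Set (pisotH β)) :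
    lebesgueH β ((fun h => c + (pisotM β ^ n) h) '' s) =
      ENNReal.ofReal (β⁻¹ ^ n) * lebesgueH β s := by
  have h1 : (fun h => c + (pisotM β ^ n) h) '' s =
      (fun h => c + h) '' (((pisotM β ^ n : pisotH β →L[ℝ] pisotH β) :
        pisotH β →ₗ[ℝ] pisotH β) '' s) := by
    rw [Set.image_image]
    rfl
  rw [h1, Set.image_add_left, measure_preimage_add, Measure.addHaar_image_linearMap]
  congr 2
  rw [ContinuousLinearMap.toLinearMap_pow, map_pow, abs_pow, abs_det_pisotM]

/-- The contraction of `H` as a continuous linear equivalence. -/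
noncomputable def pisotMEquiv : pisotH β ≃L[ℝ] pisotH β :=
  (pisotM β).toContinuousLinearEquivOfDetNeZero <| by
    have h := abs_det_pisotM β
    have h1 : (1 : ℝ) < β := IsPisotUnit.one_lt
    intro h0
    rw [ContinuousLinearMap.det] at h0
    rw [h0, abs_zero] at h
    exact (inv_pos.2 (by linarith : 0 < β)).ne h

lemma pisotMEquiv_apply (h : pisotH β) : pisotMEquiv β h = pisotM β h := rfl

lemma exists_norm_le_norm_pisotM_pow (k : ℕ) :
    ∃ L : ℝ, 0 ≤ L ∧ ∀ h : pisotH β, ‖h‖ ≤ L * ‖(pisotM β ^ k) h‖ := by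
  induction k with
  | zero => exact ⟨1, zero_le_one, fun h => by simp⟩
  | succ k ih =>
    obtain ⟨L, hL, h⟩ := ih
    set e := ((pisotMEquiv β).symm : pisotH β →L[ℝ] pisotH β)
    refine ⟨L * ‖e‖, by positivity, fun x => (h x).trans ?_⟩
    rw [mul_assoc]
    gcongr
    have := e.le_opNorm ((pisotM β ^ (k + 1)) x)
    rw [pow_succ', mul_apply_eq_comp, ← pisotMEquiv_apply] at this
    rw [pow_succ', mul_apply_eq_comp, ← pisotMEquiv_apply]
    simpa [e] using this

lemma pisotM_pow_surjective (n : ℕ) : Function.Surjective (pisotM β ^ n) := by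
  induction n with
  | zero => exact fun h => ⟨h, by simp⟩
  | succ n ih =>
    intro h
    obtain ⟨u, hu⟩ := (pisotMEquiv β).surjective h
    obtain ⟨v, rfl⟩ := ih u
    exact ⟨v, by rw [pow_succ', mul_apply_eq_comp]; exact hu⟩

lemma interior_image_affine (c : pisotH β) (s : Set (pisotH β)) :
    interior ((fun h => c + pisotM β h) '' s) = (fun h => c + pisotM β h) '' interior s :=
  (((pisotMEquiv β).toHomeomorph.trans (Homeomorph.addLeft c)).image_interior s).symm

end Measure

/-! ### The measure of the boundary as a fixed point of the transfer operator -/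

namespace RightContBetaTransformation

variable {β : ℝ} (T : RightContBetaTransformation β)

/-- The digits of the points in `T⁻¹(x)`. -/
noncomputable def preDigits (x : ℝ) : Finset ℝ :=
  open Classical in T.digits.filter fun a => (x + a) / β ∈ T.piece a

variable {T}

lemma mem_preDigits {x a : ℝ} : a ∈ T.preDigits x ↔ a ∈ T.digits ∧ (x + a) / β ∈ T.piece a := by
  simp [preDigits]

lemma map_of_mem_preDigits {x a : ℝ} (h : a ∈ T.preDigits x) :
    (x + a) / β ∈ T.X ∧ T.map ((x + a) / β) = x ∧ T.digit ((x + a) / β) = a := by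
  obtain ⟨h1, h2⟩ := mem_preDigits.1 h
  have hb := T.beta_pos
  refine ⟨T.mem_X.2 ⟨a, h1, h2⟩, ?_, T.digit_eq h1 h2⟩
  rw [T.map_eq h1 h2]
  field_simp
  ring

lemma digit_mem_preDigits {y : ℝ} (hy : y ∈ T.X) :
    T.digit y ∈ T.preDigits (T.map y) ∧ (T.map y + T.digit y) / β = y := by
  have hb := T.beta_pos
  have h : (T.map y + T.digit y) / β = y := by
    rw [map, sub_add_cancel, mul_div_cancel_left₀ _ hb.ne']
  rw [mem_preDigits, h]
  exact ⟨T.digit_mem hy, rfl⟩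

variable [IsPisotUnit β]

variable (T) in
/-- The measure of the boundary of the tile of `x`. -/
noncomputable def boundaryMeasure (x : ℝ) : ℝ≥0∞ :=
  lebesgueH β (frontier (T.branchTile T.X x))

/-- A boundary point comes from some `q` in a tile `𝒟_y`. If `q` were interior there, the affine
homeomorphism would carry a neighbourhood of it into `𝒟_x`. -/
lemma frontier_branchTile_subset {x : ℝ} :
    frontier (T.branchTile T.X x) ⊆ ⋃ a ∈ T.preDigits x,
      (fun h => pisotPhiReal β a + pisotM β h) '' frontier (T.branchTile T.X ((x + a) / β)) := by
  intro p hp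
  have hcl := (T.isClosed_branchTile subset_rfl x)
  have hpm : p ∈ T.branchTile T.X x := hcl.frontier_subset hp
  obtain ⟨y, hy, rfl, q, hq, rfl⟩ := exists_of_mem_branchTile subset_rfl hpm
  obtain ⟨h1, h2⟩ := digit_mem_preDigits hy
  refine Set.mem_iUnion₂.2 ⟨T.digit y, h1, ?_⟩
  rw [h2]
  refine ⟨q, ⟨subset_closure hq, fun hint => hp.2 ?_⟩, rfl⟩
  have hsub : (fun h => pisotPhiReal β (T.digit y) + pisotM β h) '' T.branchTile T.X y ⊆
      T.branchTile T.X (T.map y) := by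
    rintro _ ⟨r, hr, rfl⟩
    exact mem_branchTile_map (fun _ => T.map_mem) hy hr
  refine interior_mono hsub ?_
  rw [interior_image_affine]
  exact ⟨q, hint, rfl⟩

lemma measure_image_frontier (a y : ℝ) :
    lebesgueH β ((fun h => pisotPhiReal β a + pisotM β h) '' frontier (T.branchTile T.X y)) =
      ENNReal.ofReal β⁻¹ * T.boundaryMeasure y := by
  have := measure_image_affine β 1 (pisotPhiReal β a) (frontier (T.branchTile T.X y))
  rwa [pow_one, pow_one] at this

lemma boundaryMeasure_le_sum (x : ℝ) :
    T.boundaryMeasure x ≤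
      ∑ a ∈ T.preDigits x, ENNReal.ofReal β⁻¹ * T.boundaryMeasure ((x + a) / β) := by
  refine (measure_mono frontier_branchTile_subset).trans
    ((measure_biUnion_finset_le _ _).trans_eq ?_)
  exact Finset.sum_congr rfl fun a _ => measure_image_frontier a _

variable (T) in
lemma exists_boundaryMeasure_le : ∃ K : ℝ≥0∞, K ≠ ∞ ∧ ∀ x, T.boundaryMeasure x ≤ K := by
  obtain ⟨R, -, hR⟩ := T.exists_norm_le_of_mem_branchTile
  refine ⟨lebesgueH β (Metric.closedBall 0 R), measure_closedBall_lt_top.ne, fun x => ?_⟩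
  refine measure_mono fun p hp => ?_
  rw [mem_closedBall_zero_iff]
  exact hR T.X subset_rfl x p ((T.isClosed_branchTile subset_rfl x).frontier_subset hp)

lemma eventually_boundaryMeasure_eq (hA : ∀ a ∈ T.digits, a ∈ Algebra.adjoin ℤ {β})
    (hV : T.V.Finite) {x : ℝ} (hx : x ∈ T.X) :
    ∀ᶠ r in 𝓝[>] x, T.boundaryMeasure r = T.boundaryMeasure x := by
  have h1 : ∀ᶠ r in 𝓝[>] x, ∀ t ∈ T.V, t ∉ Set.Ioc x r := by
    refine (eventually_all_finite hV).2 fun t _ => ?_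
    rcases le_or_gt t x with h | h
    · exact Eventually.of_forall fun r hr => absurd hr.1 (not_lt.2 h)
    · filter_upwards [Ioo_mem_nhdsGT h] with r hr hr'
      exact absurd hr'.2 (not_le.2 hr.2)
  filter_upwards [h1, T.eventually_mem_X_right hx, self_mem_nhdsWithin] with r h1 h2 h3
  rw [boundaryMeasure, boundaryMeasure,
    branchTile_eq_of_Ioc hA hV (le_of_lt h3) h2 fun t ht hV => h1 t hV ht]

lemma eventually_boundaryMeasure_eq_left (hA : ∀ a ∈ T.digits, a ∈ Algebra.adjoin ℤ {β})
    (hV : T.V.Finite) {x : ℝ} (hx : x ∈ T.X) (hxV : x ∉ T.V) :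
    ∀ᶠ r in 𝓝[<] x, T.boundaryMeasure r = T.boundaryMeasure x := by
  have h1 : ∀ᶠ r in 𝓝[<] x, ∀ t ∈ T.V, t ∉ Set.Ioc r x := by
    refine (eventually_all_finite hV).2 fun t ht => ?_
    rcases lt_or_ge t x with h | h
    · filter_upwards [Ioo_mem_nhdsLT h] with r hr hr'
      exact absurd hr'.1 (not_lt.2 hr.1.le)
    · refine Eventually.of_forall fun r hr => hxV ?_
      rwa [le_antisymm h hr.2]
  filter_upwards [h1, self_mem_nhdsWithin] with r h1 h3
  rw [boundaryMeasure, boundaryMeasure,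
    branchTile_eq_of_Ioc hA hV (le_of_lt h3) hx fun t ht hV => h1 t hV ht]

omit [IsPisotUnit β] in
variable (T) in
lemma measurableSet_piece (a : ℝ) : MeasurableSet (T.piece a) :=
  Finset.measurableSet_biUnion _ fun _ _ => measurableSet_Ico

omit [IsPisotUnit β] in
variable (T) in
lemma measurableSet_X : MeasurableSet T.X :=
  Finset.measurableSet_biUnion _ fun a _ => T.measurableSet_piece a

/-- The function is locally constant on the open set `X \ 𝒱`, zero off `X`, and `𝒱` is finite. -/
lemma measurable_boundaryMeasure (hA : ∀ a ∈ T.digits, a ∈ Algebra.adjoin ℤ {β})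
    (hV : T.V.Finite) : Measurable (T.X.indicator T.boundaryMeasure) := by
  set f := T.X.indicator T.boundaryMeasure with hf
  intro B _
  have hopen : IsOpen ((T.X \ T.V) ∩ f ⁻¹' B) := by
    rw [isOpen_iff_eventually]
    rintro s ⟨⟨hs, hsV⟩, hsB⟩
    have hsl : s ∈ T.leftX := by
      by_contra hcon
      exact hsV (T.diff_subset_V ⟨hs, hcon⟩)
    have hnear : ∀ᶠ r in 𝓝 s, r ∈ T.X ∧ T.boundaryMeasure r = T.boundaryMeasure s := by
      rw [← nhdsLT_sup_nhdsGE, ← Set.Ioi_insert, nhdsWithin_insert, eventually_sup, eventually_sup]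
      exact ⟨(T.eventually_mem_X_left hsl).and (eventually_boundaryMeasure_eq_left hA hV hs hsV),
        by simpa using hs,
        (T.eventually_mem_X_right hs).and (eventually_boundaryMeasure_eq hA hV hs)⟩
    filter_upwards [hnear, hV.isClosed.isOpen_compl.mem_nhds hsV] with r h1 h2
    refine ⟨⟨h1.1, h2⟩, ?_⟩
    rw [Set.mem_preimage, hf, Set.indicator_of_mem hs] at hsB
    rwa [Set.mem_preimage, hf, Set.indicator_of_mem h1.1, h1.2]
  have hcompl : MeasurableSet (T.Xᶜ ∩ f ⁻¹' B) := by
    by_cases h0 : (0 : ℝ≥0∞) ∈ B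
    · convert T.measurableSet_X.compl using 1
      refine Set.inter_eq_left.2 fun s hs => ?_
      rwa [Set.mem_preimage, hf, Set.indicator_of_notMem hs]
    · convert MeasurableSet.empty using 1
      refine Set.eq_empty_iff_forall_notMem.2 ?_
      rintro s ⟨hs, hsB⟩
      rw [Set.mem_preimage, hf, Set.indicator_of_notMem hs] at hsB
      exact h0 hsB
  have e : f ⁻¹' B = ((T.X \ T.V) ∩ f ⁻¹' B) ∪ (T.V ∩ f ⁻¹' B) ∪ (T.Xᶜ ∩ f ⁻¹' B) := by
    ext s
    simp only [Set.mem_union, Set.mem_inter_iff, Set.mem_sdiff, Set.mem_compl_iff]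
    tauto
  rw [e]
  exact (hopen.measurableSet.union (hV.inter_of_left _).measurableSet).union hcompl

variable (T) in
/-- The sum of the measures of the pieces that cover the boundary of the tile of `x`. -/
noncomputable def preBoundaryMeasure (x : ℝ) : ℝ≥0∞ :=
  ∑ a ∈ T.digits, ENNReal.ofReal β⁻¹ * (T.piece a).indicator T.boundaryMeasure ((x + a) / β)

lemma preBoundaryMeasure_eq (x : ℝ) : T.preBoundaryMeasure x =
    ∑ a ∈ T.preDigits x, ENNReal.ofReal β⁻¹ * T.boundaryMeasure ((x + a) / β) := by
  classical
  rw [preBoundaryMeasure, preDigits, Finset.sum_filter]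
  refine Finset.sum_congr rfl fun a _ => ?_
  rw [Set.indicator_apply]
  split_ifs <;> simp

omit [IsPisotUnit β] in
lemma sum_indicator_piece (f : ℝ → ℝ≥0∞) (x : ℝ) :
    ∑ a ∈ T.digits, (T.piece a).indicator f x = T.X.indicator f x := by
  by_cases hx : x ∈ T.X
  · obtain ⟨h1, h2⟩ := T.digit_mem hx
    rw [Set.indicator_of_mem hx, Finset.sum_eq_single _ _ (fun h => absurd h1 h),
      Set.indicator_of_mem h2]
    intro a ha hne
    refine Set.indicator_of_notMem (fun h => hne ?_) _
    rw [T.digit_eq ha h]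
  · rw [Set.indicator_of_notMem hx]
    exact Finset.sum_eq_zero fun a ha =>
      Set.indicator_of_notMem (fun h => hx (T.mem_X.2 ⟨a, ha, h⟩)) _

lemma measurable_indicator_piece (hA : ∀ a ∈ T.digits, a ∈ Algebra.adjoin ℤ {β})
    (hV : T.V.Finite) {a : ℝ} (ha : a ∈ T.digits) :
    Measurable ((T.piece a).indicator T.boundaryMeasure) := by
  have h := (measurable_boundaryMeasure hA hV).indicator (T.measurableSet_piece a)
  rwa [Set.indicator_indicator, Set.inter_eq_left.2
    fun s hs => T.mem_X.2 ⟨a, ha, hs⟩] at h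

lemma measurable_preBoundaryMeasure (hA : ∀ a ∈ T.digits, a ∈ Algebra.adjoin ℤ {β})
    (hV : T.V.Finite) : Measurable T.preBoundaryMeasure := by
  unfold preBoundaryMeasure
  refine Finset.measurable_fun_sum _ fun a ha => ?_
  exact ((measurable_indicator_piece hA hV ha).comp (by fun_prop)).const_mul _

/-- The substitution `x ↦ (x + a) / β` absorbs the factor `β⁻¹`, and the pieces `X_a` partition `X`.
-/
lemma lintegral_preBoundaryMeasure (hA : ∀ a ∈ T.digits, a ∈ Algebra.adjoin ℤ {β})
    (hV : T.V.Finite) :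
    ∫⁻ x, T.preBoundaryMeasure x = ∫⁻ x, T.X.indicator T.boundaryMeasure x := by
  have hb := T.beta_pos
  have hm := fun a ha => measurable_indicator_piece (T := T) hA hV (a := a) ha
  have hm' : ∀ a ∈ T.digits,
      Measurable fun x => (T.piece a).indicator T.boundaryMeasure ((x + a) / β) :=
    fun a ha => (hm a ha).comp (by fun_prop)
  simp only [preBoundaryMeasure, ← sum_indicator_piece (T := T)]
  rw [lintegral_finsetSum _ fun a ha => (hm' a ha).const_mul _, lintegral_finsetSum _ hm]
  refine Finset.sum_congr rfl fun a ha => ?_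
  rw [lintegral_const_mul _ (hm' a ha),
    lintegral_add_right_eq_self
      (fun x => (T.piece a).indicator T.boundaryMeasure (x / β)) a]
  conv_rhs => rw [← Real.smul_map_volume_mul_left (inv_ne_zero hb.ne'),
    lintegral_smul_measure, lintegral_map (hm a ha) (by fun_prop), abs_of_pos (inv_pos.2 hb)]
  simp only [smul_eq_mul, div_eq_inv_mul]

/-- The covering of the boundary of a tile by the boundaries of its pieces is tight in measure. -/
lemma boundaryMeasure_eq (hA : ∀ a ∈ T.digits, a ∈ Algebra.adjoin ℤ {β})
    (hV : T.V.Finite) {x : ℝ} (hx : x ∈ T.X) :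
    T.boundaryMeasure x = T.preBoundaryMeasure x := by
  have hb := T.beta_pos
  have hle : ∀ x, T.X.indicator T.boundaryMeasure x ≤ T.preBoundaryMeasure x := fun x => by
    refine (Set.indicator_le_self _ _ x).trans ?_
    rw [preBoundaryMeasure_eq]
    exact boundaryMeasure_le_sum x
  have hfin : ∫⁻ x, T.X.indicator T.boundaryMeasure x ≠ ∞ := by
    obtain ⟨K, hK, hle⟩ := T.exists_boundaryMeasure_le
    obtain ⟨D, hD⟩ := T.exists_abs_le_of_mem_X
    have h1 : ∫⁻ x, T.X.indicator T.boundaryMeasure x ≤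
        ∫⁻ x, (Set.Icc (-D) D).indicator (fun _ => K) x := by
      refine lintegral_mono fun x => ?_
      by_cases hx : x ∈ T.X
      · rw [Set.indicator_of_mem hx, Set.indicator_of_mem (Set.mem_Icc.2 (abs_le.1 (hD x hx)))]
        exact hle x
      · rw [Set.indicator_of_notMem hx]
        exact zero_le
    rw [lintegral_indicator measurableSet_Icc, setLIntegral_const, Real.volume_Icc] at h1
    exact ne_top_of_le_ne_top (ENNReal.mul_ne_top hK ENNReal.ofReal_ne_top) h1
  have hae := ae_eq_of_ae_le_of_lintegral_le (Eventually.of_forall hle) hfin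
    (measurable_preBoundaryMeasure hA hV).aemeasurable (lintegral_preBoundaryMeasure hA hV).le
  -- Almost everywhere equality becomes equality at `x`: both functions keep their values on an
  -- interval to the right of `x`, which has positive measure and so contains a point of equality.
  have hnear : ∀ᶠ r in 𝓝[>] x, T.X.indicator T.boundaryMeasure r = T.boundaryMeasure x ∧
      T.preBoundaryMeasure r = T.preBoundaryMeasure x := by
    have h2 : ∀ᶠ r in 𝓝[>] x, ∀ a ∈ T.digits,
        (T.piece a).indicator T.boundaryMeasure ((r + a) / β) =
          (T.piece a).indicator T.boundaryMeasure ((x + a) / β) := by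
      rw [Finset.eventually_all]
      intro a ha
      have htend : Tendsto (fun r => (r + a) / β) (𝓝[>] x) (𝓝[>] ((x + a) / β)) := by
        have := tendsto_affine_right (inv_pos.2 hb) (-(a / β)) x
        have e : ∀ r, β⁻¹ * r - -(a / β) = (r + a) / β := fun r => by field_simp; ring
        simpa only [e] using this
      refine htend.eventually (p := fun s => (T.piece a).indicator T.boundaryMeasure s = _) ?_
      by_cases h : (x + a) / β ∈ T.piece a
      · filter_upwards [T.eventually_mem_piece_right h,
          eventually_boundaryMeasure_eq hA hV (T.mem_X.2 ⟨a, ha, h⟩)] with s h1 h2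
        rw [Set.indicator_of_mem h1, Set.indicator_of_mem h, h2]
      · filter_upwards [T.eventually_notMem_piece_right h] with s h1
        rw [Set.indicator_of_notMem h1, Set.indicator_of_notMem h]
    filter_upwards [T.eventually_mem_X_right hx, eventually_boundaryMeasure_eq hA hV hx, h2]
      with r h1 h2 h3
    refine ⟨by rw [Set.indicator_of_mem h1, h2], ?_⟩
    exact Finset.sum_congr rfl fun a ha => by rw [h3 a ha]
  obtain ⟨u, hu, hsub⟩ := (mem_nhdsGT_iff_exists_Ioo_subset).1 hnear
  have hpos : (volume (Set.Ioo x u)) ≠ 0 := by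
    rw [Real.volume_Ioo]
    simpa using hu
  obtain ⟨r, hr1, hr2⟩ := nonempty_of_measure_ne_zero
    (μ := volume) (s := Set.Ioo x u ∩ {r | T.X.indicator T.boundaryMeasure r =
      T.preBoundaryMeasure r}) (by rwa [measure_inter_conull hae])
  obtain ⟨h1, h2⟩ := hsub hr1
  rw [← h1, ← h2]
  exact hr2

/-- The pieces have total measure equal to that of the boundary they cover, which is finite, so none
can protrude from it by more than a null set. -/
lemma measure_image_frontier_diff (hA : ∀ a ∈ T.digits, a ∈ Algebra.adjoin ℤ {β})
    (hV : T.V.Finite) {y : ℝ} (hy : y ∈ T.X) :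
    lebesgueH β ((fun h => pisotPhiReal β (T.digit y) + pisotM β h) ''
      frontier (T.branchTile T.X y) \ frontier (T.branchTile T.X (T.map y))) = 0 := by
  obtain ⟨h1, h2⟩ := digit_mem_preDigits hy
  obtain ⟨K, hK, hle⟩ := T.exists_boundaryMeasure_le
  have := measure_diff_eq_zero_of_sum_le (μ := lebesgueH β) (s := T.preDigits (T.map y))
    (E := fun a => (fun h => pisotPhiReal β a + pisotM β h) ''
      frontier (T.branchTile T.X ((T.map y + a) / β)))
    (A := frontier (T.branchTile T.X (T.map y))) isClosed_frontier.measurableSet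
    frontier_branchTile_subset (ne_top_of_le_ne_top hK (hle _)) ?_ h1
  · rwa [h2] at this
  · refine le_of_eq ?_
    have e := boundaryMeasure_eq hA hV (T.map_mem hy)
    rw [preBoundaryMeasure_eq] at e
    refine Eq.trans ?_ e.symm
    exact Finset.sum_congr rfl fun a _ => measure_image_frontier a _

lemma measure_image_iterate_frontier_diff (hA : ∀ a ∈ T.digits, a ∈ Algebra.adjoin ℤ {β})
    (hV : T.V.Finite) (n : ℕ) {y : ℝ} (hy : y ∈ T.X) :
    lebesgueH β ((fun h => pisotPhiReal β (β ^ n * y - T.map^[n] y) + (pisotM β ^ n) h) ''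
      frontier (T.branchTile T.X y) \ frontier (T.branchTile T.X (T.map^[n] y))) = 0 := by
  induction n with
  | zero =>
    have h0 : pisotPhiReal β (β ^ 0 * y - T.map^[0] y) = 0 := by
      rw [pow_zero, one_mul, Function.iterate_zero_apply, sub_self]
      exact (pisotPhiReal_coe β 0).trans (pisotPhi_zero β)
    rw [h0]
    simp
  | succ n ih =>
    set z := T.map^[n] y with hz
    have hzX : z ∈ T.X := T.iterate_map_mem hy n
    set F : pisotH β → pisotH β := fun h => pisotPhiReal β (T.digit z) + pisotM β h with hF
    have hcomp : (fun h => pisotPhiReal β (β ^ (n + 1) * y - T.map^[n + 1] y) +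
        (pisotM β ^ (n + 1)) h) =
        F ∘ fun h => pisotPhiReal β (β ^ n * y - z) + (pisotM β ^ n) h := by
      funext h
      have hd := hA _ (T.digit_mem hzX).1
      have h1 := T.sub_iterate_map_mem hA n hy
      have hβ : β ∈ Algebra.adjoin ℤ {β} := Algebra.subset_adjoin rfl
      rw [Function.comp_apply, hF]
      simp only
      rw [map_add, ← add_assoc, ← pisotPhiReal_mul β h1,
        ← pisotPhiReal_add β hd (mul_mem hβ h1), pow_succ' (pisotM β), mul_apply_eq_comp,
        Function.iterate_succ_apply', ← hz, map]
      congr 2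
      ring
    rw [hcomp, Set.image_comp, Function.iterate_succ_apply', ← hz]
    set E := (fun h => pisotPhiReal β (β ^ n * y - z) + (pisotM β ^ n) h) ''
      frontier (T.branchTile T.X y)
    -- What leaves the boundary after `n + 1` steps either left it after `n` steps, or leaves it in
    -- the last step.
    have hsub : F '' E \ frontier (T.branchTile T.X (T.map z)) ⊆
        F '' (E \ frontier (T.branchTile T.X z)) ∪
          (F '' frontier (T.branchTile T.X z) \ frontier (T.branchTile T.X (T.map z))) := by
      rintro _ ⟨⟨q, hq, rfl⟩, hn⟩
      by_cases hqz : q ∈ frontier (T.branchTile T.X z)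
      · exact Or.inr ⟨⟨q, hqz, rfl⟩, hn⟩
      · exact Or.inl ⟨q, ⟨hq, hqz⟩, rfl⟩
    refine measure_mono_null hsub (measure_union_null ?_ (measure_image_frontier_diff hA hV hzX))
    have := measure_image_affine β 1 (pisotPhiReal β (T.digit z))
      (E \ frontier (T.branchTile T.X z))
    rw [ih, mul_zero, pow_one] at this
    exact this

end RightContBetaTransformation

/-! ### Relative density of `Φ(ℤ[β] ∩ (u, v))` in `H` -/

section Density

variable (β : ℝ) [IsPisotUnit β]

lemma genBeta_inv_pow_mul_mem (k : ℕ) {x : ℚ⟮β⟯} (hx : (x : ℝ) ∈ Algebra.adjoin ℤ {β}) :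
    (((genBeta β)⁻¹ ^ k * x : ℚ⟮β⟯) : ℝ) ∈ Algebra.adjoin ℤ {β} := by
  induction k with
  | zero => simpa using hx
  | succ k ih =>
    rw [pow_succ', mul_assoc]
    exact genBeta_inv_mul_mem β ih

/-- The images under `Φ` of the points of `ℤ[β]` in an interval are relatively dense in `H`. -/
lemma exists_lattice_point_Ioo {u v : ℝ} (huv : u < v) :
    ∃ R : ℝ, ∀ h : pisotH β, ∃ x : ℚ⟮β⟯, (x : ℝ) ∈ Algebra.adjoin ℤ {β} ∧
      (x : ℝ) ∈ Set.Ioo u v ∧ ‖pisotPhi β x - h‖ ≤ R := by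
  have h1 : (1 : ℝ) < β := IsPisotUnit.one_lt
  have hb : 0 < β := by linarith
  obtain ⟨R, hR⟩ := exists_lattice_point_near β
  obtain ⟨k, hk⟩ := pow_unbounded_of_one_lt (R / ((v - u) / 2)) h1
  rw [div_lt_iff₀ (by linarith)] at hk
  obtain ⟨L, hL0, hL⟩ := exists_norm_le_norm_pisotM_pow β k
  refine ⟨L * R, fun h => ?_⟩
  -- Multiplication by `β^k` stretches the interval enough to contain a lattice point; dividing back
  -- by `β^k` stays in `ℤ[β]` and enlarges the error in `H` only by the constant `L`.
  obtain ⟨x, hx, hx1, hx2⟩ := hR (β ^ k * ((u + v) / 2)) ((pisotM β ^ k) h)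
  set y := (genBeta β)⁻¹ ^ k * x with hy
  have hxy : x = genBeta β ^ k * y := by
    rw [hy, ← mul_assoc, ← mul_pow, mul_inv_cancel₀ (genBeta_ne_zero β), one_pow, one_mul]
  have hxyr : (x : ℝ) = β ^ k * (y : ℝ) := by
    conv_lhs => rw [hxy]
    rfl
  refine ⟨y, genBeta_inv_pow_mul_mem β k hx, ?_, ?_⟩
  · rw [hxyr, ← mul_sub, abs_mul, abs_of_pos (pow_pos hb k)] at hx1
    have h2 : |(y : ℝ) - (u + v) / 2| < (v - u) / 2 :=
      lt_of_mul_lt_mul_left (hx1.trans_lt hk) (pow_pos hb k).le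
    rw [abs_lt] at h2
    constructor <;> linarith
  · refine (hL _).trans ?_
    rw [map_sub, ← pisotPhi_genBeta_pow_mul, ← hxy]
    gcongr

lemma countable_adjoin : {x : ℚ⟮β⟯ | (x : ℝ) ∈ Algebra.adjoin ℤ {β}}.Countable := by
  refine (Set.countable_iUnion fun n : ℕ => (finite_lattice_points β n).countable).mono ?_
  intro x hx
  obtain ⟨n, hn⟩ := exists_nat_ge (max |(x : ℝ)| ‖pisotPhi β x‖)
  exact Set.mem_iUnion.2 ⟨n, hx, (le_max_left _ _).trans hn, (le_max_right _ _).trans hn⟩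

end Density

/-! ### Covering of `H` by subtiles and the contradiction -/

namespace RightContBetaTransformation

variable {β : ℝ} {T : RightContBetaTransformation β} [IsPisotUnit β]

/-- The translates `Φ(x) + 𝒟_x`, `x ∈ ℤ[β] ∩ S`, cover `H`, for every invariant set `S` that
contains an interval. -/
lemma exists_sub_mem_branchTile (hA : ∀ a ∈ T.digits, a ∈ Algebra.adjoin ℤ {β})
    {S : Set ℝ} (hS : S ⊆ T.X) (hSm : Set.MapsTo T.map S S)
    (hsurj : ∀ x ∈ S, ∃ y ∈ S, T.map y = x) {u v : ℝ} (huv : u < v) (hI : Set.Ioo u v ⊆ S)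
    (h : pisotH β) : ∃ x : ℚ⟮β⟯, (x : ℝ) ∈ Algebra.adjoin ℤ {β} ∧ (x : ℝ) ∈ S ∧
      h - pisotPhi β x ∈ T.branchTile S x := by
  obtain ⟨C, ρ, hC, hρ0, hρ1, hM⟩ := exists_norm_pisotM_pow_le β
  obtain ⟨R, hR0, hR⟩ := T.exists_norm_le_of_mem_branchTile
  obtain ⟨R', hR'⟩ := exists_lattice_point_Ioo β huv
  obtain ⟨D, hD⟩ := T.exists_abs_le_of_mem_X
  -- approximations of `h` by points of the translates
  have happrox : ∀ n : ℕ, ∃ x : ℚ⟮β⟯, (x : ℝ) ∈ Algebra.adjoin ℤ {β} ∧ (x : ℝ) ∈ S ∧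
      ∃ p ∈ T.branchTile S x, ‖p + pisotPhi β x - h‖ ≤ C * ρ ^ n * (R' + R) := by
    intro n
    -- A point `Φ(y)` near `M^{-n} h` is pushed forward: with `x = T^n y`, the translate of the
    -- subtile of `x` contains `M^n (Φ(y) + q)`, whose distance to `h` decays like `ρ^n`.
    obtain ⟨hn, rfl⟩ := pisotM_pow_surjective β n h
    obtain ⟨y, hy, hyI, hyn⟩ := hR' hn
    have hyS := hI hyI
    obtain ⟨q, hq⟩ := branchTile_nonempty hS hsurj hyS
    have hmem := mem_branchTile_iterate hA hS hSm n hyS hq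
    have hd := T.sub_iterate_map_mem hA n (hS hyS)
    have hβ : β ∈ Algebra.adjoin ℤ {β} := Algebra.subset_adjoin rfl
    have hxm : T.map^[n] (y : ℝ) ∈ Algebra.adjoin ℤ {β} := by
      have := sub_mem (mul_mem (pow_mem hβ n) hy) hd
      rwa [sub_sub_cancel] at this
    obtain ⟨x, hx⟩ := exists_coe_eq β hxm
    rw [← hx] at hmem hd hxm
    refine ⟨x, hxm, by rw [hx]; exact hSm.iterate n hyS, _, hmem, ?_⟩
    have e : pisotPhiReal β (β ^ n * y - x) + pisotPhi β x = (pisotM β ^ n) (pisotPhi β y) := by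
      rw [← pisotPhiReal_coe, ← pisotPhiReal_add β hd hxm, sub_add_cancel,
        pisotPhiReal_pow_mul β n hy, pisotPhiReal_coe]
    rw [add_right_comm, e, add_sub_right_comm, ← map_sub, ← map_add]
    refine (hM n _).trans ?_
    gcongr
    exact (norm_add_le _ _).trans (add_le_add hyn (hR S hS _ _ hq))
  have hRR : 0 ≤ R' + R := by
    obtain ⟨y, -, -, hyn⟩ := hR' h
    have := (norm_nonneg _).trans hyn
    linarith
  -- All `x` occurring in the approximations satisfy `|x| ≤ K` and `‖Φ(x)‖ ≤ K`, so they form a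
  -- finite set. The translates are closed, hence one of them contains `h`.
  set K := max D (‖h‖ + R + C * (R' + R))
  have hfin := finite_lattice_points β K
  by_contra! hcon
  have hev : ∀ᶠ n : ℕ in atTop, ∀ x ∈ {x : ℚ⟮β⟯ | (x : ℝ) ∈ Algebra.adjoin ℤ {β} ∧
      |(x : ℝ)| ≤ K ∧ ‖pisotPhi β x‖ ≤ K}, (x : ℝ) ∈ S → ∀ p ∈ T.branchTile S x,
      C * ρ ^ n * (R' + R) < ‖p + pisotPhi β x - h‖ := by
    refine (eventually_all_finite hfin).2 fun x hx => ?_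
    by_cases hxS : (x : ℝ) ∈ S
    · have hopen := (T.isClosed_branchTile hS x).isOpen_compl
      obtain ⟨ε, hε, hball⟩ := Metric.isOpen_iff.1 hopen _ (hcon x hx.1 hxS)
      have hlim : Tendsto (fun n : ℕ => C * ρ ^ n * (R' + R)) atTop (𝓝 0) := by
        have := ((tendsto_pow_atTop_nhds_zero_of_lt_one hρ0.le hρ1).const_mul C).mul_const (R' + R)
        simpa using this
      filter_upwards [hlim.eventually (gt_mem_nhds hε)] with n hn _ p hp
      refine hn.trans_le (not_lt.1 fun hlt => hball ?_ hp)
      rw [mem_ball_iff_norm, sub_sub_eq_add_sub]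
      exact hlt
    · exact Eventually.of_forall fun n h => absurd h hxS
  obtain ⟨n, hn⟩ := hev.exists
  obtain ⟨x, hx, hxS, p, hp, hpn⟩ := happrox n
  refine absurd hpn (not_le.2 (hn x ⟨hx, ?_, ?_⟩ hxS p hp))
  · exact (hD _ (hS hxS)).trans (le_max_left _ _)
  · refine le_trans ?_ (le_max_right _ _)
    have e : pisotPhi β x = h - p + (p + pisotPhi β x - h) := by abel
    have h1 : C * ρ ^ n * (R' + R) ≤ C * 1 * (R' + R) := by
      gcongr
      exact pow_le_one₀ hρ0.le hρ1.le
    have h2 := hR S hS _ _ hp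
    have h3 := norm_add_le (h - p) (p + pisotPhi β x - h)
    have h4 := norm_sub_le h p
    rw [e]
    linarith

/-- Baire's theorem applies: `ℤ[β]` is countable and the translated subtiles are closed and cover
`H`. -/
lemma exists_interior_branchTile_nonempty (hA : ∀ a ∈ T.digits, a ∈ Algebra.adjoin ℤ {β})
    {S : Set ℝ} (hS : S ⊆ T.X) (hSm : Set.MapsTo T.map S S)
    (hsurj : ∀ x ∈ S, ∃ y ∈ S, T.map y = x) {u v : ℝ} (huv : u < v) (hI : Set.Ioo u v ⊆ S) :
    ∃ x ∈ S, (interior (T.branchTile S x)).Nonempty := by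
  set ι := {x : ℚ⟮β⟯ // (x : ℝ) ∈ Algebra.adjoin ℤ {β} ∧ (x : ℝ) ∈ S}
  have hcount : Countable ι := ((countable_adjoin β).mono fun x hx => hx.1 :
    {x : ℚ⟮β⟯ | (x : ℝ) ∈ Algebra.adjoin ℤ {β} ∧ (x : ℝ) ∈ S}.Countable).to_subtype
  set F : ι → Set (pisotH β) := fun x =>
    Homeomorph.subRight (pisotPhi β x.1) ⁻¹' T.branchTile S x.1 with hF
  have hclosed : ∀ i, IsClosed (F i) := fun i =>
    (T.isClosed_branchTile hS _).preimage (Homeomorph.subRight _).continuous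
  have hcover : ⋃ i, F i = Set.univ := by
    refine Set.eq_univ_of_forall fun h => ?_
    obtain ⟨x, hx, hxS, hmem⟩ := exists_sub_mem_branchTile hA hS hSm hsurj huv hI h
    exact Set.mem_iUnion.2 ⟨⟨x, hx, hxS⟩, hmem⟩
  obtain ⟨i, p, hp⟩ := nonempty_interior_of_iUnion_of_closed hclosed hcover
  rw [hF, ← Homeomorph.preimage_interior] at hp
  exact ⟨_, i.2.2, _, hp⟩

/-- The boundary of every tile has measure zero. -/
lemma boundaryMeasure_eq_zero (hA : ∀ a ∈ T.digits, a ∈ Algebra.adjoin ℤ {β})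
    (hV : T.V.Finite) {x₀ : ℝ} (hx₀ : x₀ ∈ T.X) : T.boundaryMeasure x₀ = 0 := by
  by_contra hne
  have hb := T.beta_pos
  set S := {x ∈ T.X | T.boundaryMeasure x ≠ 0} with hSdef
  have hS : S ⊆ T.X := fun x hx => hx.1
  have hβ0 : ENNReal.ofReal β⁻¹ ≠ 0 := by simpa using hb
  -- The equality for the boundary measures says that `x` is in `S` exactly if some `T`-preimage is,
  -- which yields both invariance and surjectivity on `S`.
  have hsum : ∀ {x}, x ∈ T.X → (T.boundaryMeasure x ≠ 0 ↔
      ∃ a ∈ T.preDigits x, T.boundaryMeasure ((x + a) / β) ≠ 0) := by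
    intro x hx
    rw [boundaryMeasure_eq hA hV hx, preBoundaryMeasure_eq, Ne, Finset.sum_eq_zero_iff]
    simp only [mul_eq_zero, hβ0, false_or]
    push Not
    rfl
  have hSm : Set.MapsTo T.map S S := fun y hy => by
    refine ⟨T.map_mem hy.1, (hsum (T.map_mem hy.1)).2 ?_⟩
    obtain ⟨h1, h2⟩ := digit_mem_preDigits hy.1
    exact ⟨_, h1, by rw [h2]; exact hy.2⟩
  have hsurj : ∀ x ∈ S, ∃ y ∈ S, T.map y = x := fun x hx => by
    obtain ⟨a, ha, h⟩ := (hsum hx.1).1 hx.2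
    obtain ⟨h1, h2, -⟩ := map_of_mem_preDigits ha
    exact ⟨_, ⟨h1, h⟩, h2⟩
  have hright : ∀ᶠ r in 𝓝[>] x₀, r ∈ S := by
    filter_upwards [T.eventually_mem_X_right hx₀, eventually_boundaryMeasure_eq hA hV hx₀]
      with r h1 h2
    exact ⟨h1, by rwa [h2]⟩
  obtain ⟨v, hv, hI⟩ := mem_nhdsGT_iff_exists_Ioo_subset.1 hright
  obtain ⟨x, hx, p, hp⟩ := exists_interior_branchTile_nonempty hA hS hSm hsurj hv hI
  have hp' := interior_mono (branchTile_mono hS x) hp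
  obtain ⟨ε, hε, hball⟩ := Metric.isOpen_iff.1 isOpen_interior _ hp'
  obtain ⟨C, ρ, hC, hρ0, hρ1, hM⟩ := exists_norm_pisotM_pow_le β
  obtain ⟨R, hR0, hR⟩ := T.exists_norm_le_of_mem_branchTile
  have hlim : Tendsto (fun n : ℕ => C * ρ ^ n * (R + R)) atTop (𝓝 0) := by
    have := ((tendsto_pow_atTop_nhds_zero_of_lt_one hρ0.le hρ1).const_mul C).mul_const (R + R)
    simpa using this
  obtain ⟨n, hn⟩ := (hlim.eventually (gt_mem_nhds hε)).exists
  -- Using the subtile rather than the full tile ensures that `y` belongs to `S`, so the boundary of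
  -- its tile has positive measure.
  obtain ⟨y, hy, rfl, q, hq, rfl⟩ :=
    exists_iterate_of_mem_branchTile hA hS n (interior_subset hp)
  -- the piece of the tile of `x` around `p` lies in the interior of this tile
  have hpiece : (fun h => pisotPhiReal β (β ^ n * y - T.map^[n] y) + (pisotM β ^ n) h) ''
      frontier (T.branchTile T.X y) ⊆ interior (T.branchTile T.X (T.map^[n] y)) := by
    rintro _ ⟨r, hr, rfl⟩
    refine hball ?_
    have hr' := hR T.X subset_rfl y r ((T.isClosed_branchTile subset_rfl y).frontier_subset hr)
    have hq' := hR S hS y q hq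
    rw [mem_ball_iff_norm, add_sub_add_left_eq_sub, ← map_sub]
    refine ((hM n _).trans ?_).trans_lt hn
    gcongr
    exact (norm_sub_le _ _).trans (add_le_add hr' hq')
  have hnull := measure_image_iterate_frontier_diff hA hV n hy.1
  -- Nothing is removed by the set difference, so the measure `β^{-n} μ(y)` of the whole image
  -- vanishes.
  rw [(disjoint_interior_frontier.mono_left hpiece).sdiff_eq_left, measure_image_affine,
    mul_eq_zero] at hnull
  rcases hnull with h | h
  · rw [ENNReal.ofReal_eq_zero] at h
    exact absurd (pow_pos (inv_pos.2 hb) n) (not_lt.2 h)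
  · exact hy.2 h

end RightContBetaTransformation

theorem propositionp (β : ℝ) [IsPisotUnit β] (T : RightContBetaTransformation β)
    (hA : ∀ a ∈ T.digits, a ∈ Algebra.adjoin ℤ {β}) (hV : T.V.Finite) (x : ℝ) (hx : x ∈ T.X) :
    lebesgueH β (frontier (T.tile x)) = 0 := by
  rw [RightContBetaTransformation.tile_eq_branchTile hA hx]
  exact RightContBetaTransformation.boundaryMeasure_eq_zero hA hV hx
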